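/- Let $G$ be a second-countable amenable unimodular locally compact (Hausdorff) group with Haar measure $\mu$. A (right) strong Følner sequence in $G$ is a sequence $(K_n)_{n\in\mathbb N}$ of compact sets with $\mu(K_n)>0$ such that, for all nonempty compact $L\subseteq G$, $$\lim_{n\to\infty}\frac{\mu(K_n\triangle K_nL)}{\mu(K_n)}=0\qquad\text{and}\qquad \lim_{n\to\infty}\frac{\mu(K_nL\cap K_n^cL)}{\mu(K_n)}=0 .$$ (Amenability means that there is a sequence of compact sets of positive measure with the first property.) Fix a strong Følner sequence $(K_n)$ and, for $\Lambda\subseteq G$, put $$D^-(\Lambda)=\liminf_{n\to\infty}\inf_{x\in G}\frac{|\Lambda\cap xK_n|}{\mu(K_n)},\qquad D^+(\Lambda)=\limsup_{n\to\infty}\sup_{x\in G}\frac{|\Lambda\cap xK_n|}{\mu(K_n)} .$$ Let $(\pi,\mathcal H_\pi)$ be an irreducible projective unitary representation of $G$, i.e. a strongly continuous map $\pi$ from $G$ into the unitary operators of a complex Hilbert space $\mathcal H_\pi$ such that $\pi(x)\pi(y)=\sigma(x,y)\pi(xy)$ for some $\sigma:G\times G\to\mathbb T$, and such that $\{0\}$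 and $\mathcal H_\pi$ are its only closed invariant subspaces. Assume that $\pi$ is square-integrable, i.e. $\int_G|\langle g,\pi(x)g\rangle|^2\,d\mu(x)<\infty$ for some $g\neq0$, and let $d_\pi>0$ be its formal degree, i.e. the number with $\int_G|\langle f,\pi(x)g\rangle|^2\,d\mu(x)=d_\pi^{-1}\|f\|^2\|g\|^2$ for all $f,g\in\mathcal H_\pi$. For a relatively compact unit neighborhood $Q\subseteq G$ let $$\mathcal B^2_\pi=\Big\{g\in\mathcal H_\pi:\int_G\Big(\sup_{y\in Q}|\langle f,\pi(xy)g\rangle|\Big)^2d\mu(x)<\infty\ \text{ for all } f\in\mathcal H_\pi\Big\}.$$ Let $\Lambda\subseteq G$ be discrete and $g\in\mathcal H_\pi$, and write $\pi(\Lambda)g=(\pi(\lambda)g)_{\lambda\in\Lambda}$. (i) If $g\in\mathcal B^2_\pi$ and $\pi(\Lambda)g$ is a frame for $\mathcal H_\pi$, i.e. there are $A,B>0$ with $A\|f\|^2\le\sum_{\lambda\in\Lambda}|\langle f,\pi(\lambda)g\rangle|^2\le B\|f\|^2$ for all $f\in\mathcal H_\pi$, then $D^-(\Lambda)\ge d_\pi$.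 (ii) If $\pi(\Lambda)g$ is a Riesz sequence in $\mathcal H_\pi$, i.e. there are $A,B>0$ such that for all $c\in\ell^2(\Lambda)$ the series $\sum_{\lambda\in\Lambda}c_\lambda\pi(\lambda)g$ converges unconditionally and $A\|c\|_{\ell^2}^2\le\big\|\sum_{\lambda\in\Lambda}c_\lambda\pi(\lambda)g\big\|^2\le B\|c\|_{\ell^2}^2$, then $D^+(\Lambda)\le d_\pi$. -/

import Mathlib

open MeasureTheory Filter Topology Set
open scoped ENNReal Pointwise symmDiff

/-- A (right) Følner sequence: non-null compact sets `K n` that are asymptotically invariant under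
right multiplication by every nonempty compact set. (The empty set has to be left out, because
`μ (K n ∆ (K n * ∅)) / μ (K n) = 1`.) -/
structure IsFolnerSequence {G : Type*} [Group G] [TopologicalSpace G] [MeasurableSpace G]
    (μ : Measure G) (K : ℕ → Set G) : Prop where
  isCompact : ∀ n, IsCompact (K n)
  measure_pos : ∀ n, 0 < μ (K n)
  tendsto_symmDiff : ∀ L : Set G, IsCompact L → L.Nonempty →
    Tendsto (fun n => μ (K n ∆ (K n * L)) / μ (K n)) atTop (𝓝 0)

/-- A (right) strong Følner sequence, also called a van Hove sequence. -/
structure IsStrongFolnerSequence {G : Type*} [Group G] [TopologicalSpace G] [MeasurableSpace G]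
    (μ : Measure G) (K : ℕ → Set G) : Prop extends IsFolnerSequence μ K where
  tendsto_boundary : ∀ L : Set G, IsCompact L →
    Tendsto (fun n => μ ((K n * L) ∩ ((K n)ᶜ * L)) / μ (K n)) atTop (𝓝 0)

/-- A second-countable locally compact group with Haar measure `μ` is amenable if it admits a
Følner sequence. -/
def IsAmenableGroup {G : Type*} [Group G] [TopologicalSpace G] [MeasurableSpace G]
    (μ : Measure G) : Prop :=
  ∃ K : ℕ → Set G, IsFolnerSequence μ K

/-- The lower Beurling density `liminf_n inf_x |Λ ∩ x K_n| / μ(K_n)`, as a value in `[0, ∞]`. -/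
noncomputable def lowerBeurlingDensity {G : Type*} [Group G] [MeasurableSpace G]
    (μ : Measure G) (K : ℕ → Set G) (Λ : Set G) : ℝ≥0∞ :=
  liminf (fun n => ⨅ x : G, ((Λ ∩ x • K n).encard : ℝ≥0∞) / μ (K n)) atTop

/-- The upper Beurling density `limsup_n sup_x |Λ ∩ x K_n| / μ(K_n)`, as a value in `[0, ∞]`. -/
noncomputable def upperBeurlingDensity {G : Type*} [Group G] [MeasurableSpace G]
    (μ : Measure G) (K : ℕ → Set G) (Λ : Set G) : ℝ≥0∞ :=
  limsup (fun n => ⨆ x : G, ((Λ ∩ x • K n).encard : ℝ≥0∞) / μ (K n)) atTop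

/-- A projective unitary representation of `G` on `H`: a strongly continuous map into the unitary
operators with `π(x) π(y) = σ(x, y) π(xy)` for some `σ : G × G → 𝕋`. -/
structure ProjectiveUnitaryRep (G H : Type*) [Group G] [TopologicalSpace G]
    [NormedAddCommGroup H] [InnerProductSpace ℂ H] where
  toFun : G → H ≃ₗᵢ[ℂ] H
  exists_cocycle : ∃ σ : G → G → Circle, ∀ (x y : G) (v : H),
    toFun x (toFun y v) = (σ x y : ℂ) • toFun (x * y) v
  continuous_apply : ∀ v : H, Continuous fun x => toFun x v

namespace ProjectiveUnitaryRep

variable {G H : Type*} [Group G] [TopologicalSpace G]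
  [NormedAddCommGroup H] [InnerProductSpace ℂ H]

/-- The only closed `π(G)`-invariant subspaces are `{0}` and `H`. -/
def IsIrreducible (π : ProjectiveUnitaryRep G H) : Prop :=
  ∀ W : Submodule ℂ H, IsClosed (W : Set H) → (∀ x : G, ∀ v ∈ W, π.toFun x v ∈ W) →
    W = ⊥ ∨ W = ⊤

/-- There is a nonzero `g` with `∫ |⟨g, π(x) g⟩|² dμ(x) < ∞`. -/
def IsSquareIntegrable [MeasurableSpace G] (π : ProjectiveUnitaryRep G H) (μ : Measure G) : Prop :=
  ∃ g : H, g ≠ 0 ∧ ∫⁻ x, ‖inner ℂ g (π.toFun x g)‖ₑ ^ 2 ∂μ < ∞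

/-- `d > 0` and `∫ |⟨f, π(x) g⟩|² dμ(x) = d⁻¹ ‖f‖² ‖g‖²` for all `f, g`. -/
def IsFormalDegree [MeasurableSpace G] (π : ProjectiveUnitaryRep G H) (μ : Measure G) (d : ℝ) :
    Prop :=
  0 < d ∧ ∀ f g : H, ∫⁻ x, ‖inner ℂ f (π.toFun x g)‖ₑ ^ 2 ∂μ
    = ENNReal.ofReal (d⁻¹ * ‖f‖ ^ 2 * ‖g‖ ^ 2)

open Classical in
/-- The formal degree of `π`: the number with the property `IsFormalDegree` (and `0` for a
representation for which there is none). -/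
noncomputable def formalDegree [MeasurableSpace G] (π : ProjectiveUnitaryRep G H)
    (μ : Measure G) : ℝ :=
  if h : ∃ d : ℝ, π.IsFormalDegree μ d then h.choose else 0

theorem IsFormalDegree.formalDegree_eq [MeasurableSpace G] [Nontrivial H]
    {π : ProjectiveUnitaryRep G H} {μ : Measure G} {d : ℝ} (hd : π.IsFormalDegree μ d) :
    π.formalDegree μ = d := by
  have h : ∃ d : ℝ, π.IsFormalDegree μ d := ⟨d, hd⟩
  have hc := h.choose_spec
  rw [formalDegree, dif_pos h]
  obtain ⟨v, hv⟩ := exists_ne (0 : H)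
  have hv' : 0 < ‖v‖ := norm_pos_iff.2 hv
  have hc0 := hc.1
  have hd0 := hd.1
  have e := (hc.2 v v).symm.trans (hd.2 v v)
  rw [ENNReal.ofReal_eq_ofReal_iff (by positivity) (by positivity)] at e
  exact inv_injective (mul_right_cancel₀ (pow_ne_zero 2 hv'.ne')
    (mul_right_cancel₀ (pow_ne_zero 2 hv'.ne') e))

/-- The coherent system `(π(λ) g)_{λ ∈ Λ}` is a frame for `H`. -/
def IsFrame (π : ProjectiveUnitaryRep G H) (Λ : Set G) (g : H) : Prop :=
  ∃ A B : ℝ, 0 < A ∧ 0 < B ∧ ∀ f : H,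
    ENNReal.ofReal (A * ‖f‖ ^ 2) ≤ ∑' l : Λ, ‖inner ℂ f (π.toFun l g)‖ₑ ^ 2 ∧
    ∑' l : Λ, ‖inner ℂ f (π.toFun l g)‖ₑ ^ 2 ≤ ENNReal.ofReal (B * ‖f‖ ^ 2)

/-- The coherent system `(π(λ) g)_{λ ∈ Λ}` is a Riesz sequence in `H`. -/
def IsRieszSequence (π : ProjectiveUnitaryRep G H) (Λ : Set G) (g : H) : Prop :=
  ∃ A B : ℝ, 0 < A ∧ 0 < B ∧ ∀ c : lp (fun _ : Λ => ℂ) 2,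
    Summable (fun l : Λ => c l • π.toFun l g) ∧
    A * ‖c‖ ^ 2 ≤ ‖∑' l : Λ, c l • π.toFun l g‖ ^ 2 ∧
    ‖∑' l : Λ, c l • π.toFun l g‖ ^ 2 ≤ B * ‖c‖ ^ 2

/-- The space `𝓑²_π` with respect to the unit neighborhood `Q`: all `g` with
`∫ (sup_{y ∈ Q} |⟨f, π(xy) g⟩|)² dμ(x) < ∞` for every `f`. -/
def B2 [MeasurableSpace G] (π : ProjectiveUnitaryRep G H) (μ : Measure G) (Q : Set G) : Set H :=
  {g | ∀ f : H, ∫⁻ x, (⨆ y ∈ Q, ‖inner ℂ f (π.toFun (x * y) g)‖ₑ) ^ 2 ∂μ < ∞}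

end ProjectiveUnitaryRep

/-! Fix a unit vector η. Summing the orthogonality relations over an orthonormal basis of a
finite-dimensional W gives ∫ ‖P_W π(y)η‖² dμ(y) = d_π⁻¹ dim W, with integrand at most 1
(`IsFormalDegree.lintegral_enorm_sq_starProjection`). Both density bounds compare dim W with a
number of points and the integral with a volume; L is a compact set depending only on an error δ.

Riesz sequences: the N vectors π(λ)g with λ in xK_n span a W of dimension N. The integral over xK_nL
is at most μ(K_nL). Off this set the lower Riesz bound leaves an error of at most δN, since each
|⟨π(λ)g, π(y)η⟩|² is a translate of one integrable function. Hence (d_π⁻¹ - δ)N ≤ μ(K_nL) ≤ (1 +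
o(1)) μ(K_n).

Frames: the dual frame vectors with index in xK_n span a W of dimension at most N, and ‖P_W π(y)η‖²
≥ 1 - δ whenever yL ⊆ xK_n. This needs the tails of Σ |⟨π(y)η, π(λ)g⟩|² over λ ∉ yL to be small
uniformly in y, which follows from g ∈ 𝓑²_π and the relative separation of Λ. The boundary condition
on K_n makes the set of such y almost as large as K_n.

The formal degree itself comes from Schur's lemma, applied through the closed graph of the
coefficient map (`IsIrreducible.exists_lintegral_coeff_eq`). -/

/-- A Haar measure that is also right invariant is invariant under inversion. -/
theorem isInvInvariant_of_isMulRightInvariant {G : Type*} [Group G] [TopologicalSpace G]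
    [IsTopologicalGroup G] [LocallyCompactSpace G] [SecondCountableTopology G]
    [MeasurableSpace G] [BorelSpace G] (μ : Measure G) [μ.IsHaarMeasure]
    [μ.IsMulRightInvariant] : μ.IsInvInvariant := by
  constructor
  let c : ℝ≥0∞ := Measure.haarScalarFactor μ.inv μ
  -- Right invariance makes `μ.inv` left invariant, so it is a multiple of μ; inverting twice forces
  -- c² = 1.
  have hc : μ.inv = c • μ := Measure.isMulLeftInvariant_eq_smul μ.inv μ
  have h2 : Measure.map Inv.inv (Measure.map Inv.inv μ) = c ^ 2 • μ := by
    rw [← Measure.inv_def μ, hc, Measure.map_smul, ← Measure.inv_def μ, hc, smul_smul, pow_two]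
  have μeq : μ = c ^ 2 • μ := by
    rw [Measure.map_map continuous_inv.measurable continuous_inv.measurable] at h2
    simpa only [inv_involutive, Function.Involutive.comp_self, Measure.map_id] using h2
  let K : TopologicalSpace.PositiveCompacts G := Classical.arbitrary _
  have h3 : c ^ 2 * μ K = 1 ^ 2 * μ K := by
    conv_rhs => rw [μeq]
    simp
  have h4 : c ^ 2 = 1 ^ 2 :=
    (ENNReal.mul_left_inj (Measure.measure_pos_of_nonempty_interior _ K.interior_nonempty).ne'
          K.isCompact.measure_lt_top.ne).1 h3
  have h5 : c = 1 := (ENNReal.pow_right_strictMono two_ne_zero).injective h4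
  rw [hc, h5, one_smul]

namespace ProjectiveUnitaryRep

/-! ### Matrix coefficients under translation and inversion -/

section Algebra

variable {G H : Type*} [Group G] [TopologicalSpace G]
  [NormedAddCommGroup H] [InnerProductSpace ℂ H] (π : ProjectiveUnitaryRep G H)

/-- The matrix coefficient `y ↦ ⟨π(y) g, f⟩`. -/
noncomputable def coeff (g f : H) (y : G) : ℂ := inner ℂ (π.toFun y g) f

theorem continuous_coeff (g f : H) : Continuous (π.coeff g f) :=
  (π.continuous_apply g).inner continuous_const

theorem enorm_inner_eq_coeff (f g : H) (x : G) :
    ‖inner ℂ f (π.toFun x g)‖ₑ = ‖π.coeff g f x‖ₑ := by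
  rw [← ofReal_norm, ← ofReal_norm, coeff, norm_inner_symm]

/-- Matrix coefficients of `π(x) f` are, up to a phase that does not depend on `f`, left translates
of those of `f`. -/
theorem exists_coeff_translate (x : G) : ∃ θ : G → Circle, ∀ (g f : H) (y : G),
    π.coeff g (π.toFun x f) y = (θ y : ℂ) * π.coeff g f (x⁻¹ * y) := by
  obtain ⟨σ, hσ⟩ := π.exists_cocycle
  refine ⟨fun y => σ x (x⁻¹ * y), fun g f y => ?_⟩
  have h := hσ x (x⁻¹ * y) g
  rw [mul_inv_cancel_left] at h
  have h2 : inner ℂ (π.toFun x (π.toFun (x⁻¹ * y) g)) (π.toFun x f)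
      = inner ℂ (π.toFun (x⁻¹ * y) g) f := LinearIsometryEquiv.inner_map_map _ _ _
  rw [h, inner_smul_left] at h2
  rw [coeff, coeff, ← h2, ← mul_assoc, Complex.mul_conj, Circle.normSq_coe]
  simp

theorem norm_coeff_translate (x : G) (g f : H) (y : G) :
    ‖π.coeff g (π.toFun x f) y‖ = ‖π.coeff g f (x⁻¹ * y)‖ := by
  obtain ⟨θ, hθ⟩ := π.exists_coeff_translate x
  rw [hθ, norm_mul, Circle.norm_coe, one_mul]

theorem exists_toFun_one : ∃ z : Circle, ∀ v, π.toFun 1 v = (z : ℂ) • v := by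
  obtain ⟨σ, hσ⟩ := π.exists_cocycle
  refine ⟨σ 1 1, fun v => (π.toFun 1).injective ?_⟩
  rw [hσ, mul_one, map_smul]

theorem norm_coeff_one (g f : H) : ‖π.coeff g f 1‖ = ‖inner ℂ g f‖ := by
  obtain ⟨z, hz⟩ := π.exists_toFun_one
  rw [coeff, hz, inner_smul_left, norm_mul, RCLike.norm_conj, Circle.norm_coe, one_mul]

theorem norm_coeff_swap (g f : H) (x : G) : ‖π.coeff g f x‖ = ‖π.coeff f g x⁻¹‖ := by
  have h := π.norm_coeff_translate x f g 1
  rw [mul_one] at h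
  rw [← h, norm_coeff_one, coeff, norm_inner_symm]

theorem exists_eq_toFun (x : G) (v : H) : ∃ w : H, v = π.toFun x w :=
  ⟨(π.toFun x).symm v, by simp⟩

variable [MeasurableSpace G] [BorelSpace G]
  (μ : Measure G)

theorem lintegral_coeff_translate [ContinuousMul G] [μ.IsMulLeftInvariant] (g f : H) (x : G) :
    ∫⁻ y, ‖π.coeff g (π.toFun x f) y‖ₑ ^ 2 ∂μ = ∫⁻ y, ‖π.coeff g f y‖ₑ ^ 2 ∂μ := by
  rw [← lintegral_mul_left_eq_self (fun y => ‖π.coeff g f y‖ₑ ^ 2) x⁻¹]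
  simp only [← ofReal_norm, norm_coeff_translate]

theorem lintegral_coeff_swap [ContinuousInv G] [μ.IsInvInvariant] (g f : H) :
    ∫⁻ y, ‖π.coeff g f y‖ₑ ^ 2 ∂μ = ∫⁻ y, ‖π.coeff f g y‖ₑ ^ 2 ∂μ := by
  rw [← lintegral_inv_eq_self (fun y => ‖π.coeff f g y‖ₑ ^ 2)]
  simp only [← ofReal_norm, norm_coeff_swap π g f]

theorem memLp_coeff (g f : H) :
    MemLp (π.coeff g f) 2 μ ↔ ∫⁻ y, ‖π.coeff g f y‖ₑ ^ 2 ∂μ < ∞ := by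
  rw [MemLp, and_iff_right (π.continuous_coeff g f).aestronglyMeasurable,
    eLpNorm_lt_top_iff_lintegral_rpow_enorm_lt_top (by norm_num) (by norm_num)]
  simp

/-- The phase produced by the cocycle depends on y but not on the vector, so it cancels in the
product. -/
theorem integral_conj_coeff_translate [ContinuousMul G] [μ.IsMulLeftInvariant] (g f f' : H) (x : G) :
    ∫ y, inner ℂ (π.coeff g (π.toFun x f) y) (π.coeff g (π.toFun x f') y) ∂μ
      = ∫ y, inner ℂ (π.coeff g f y) (π.coeff g f' y) ∂μ := by
  obtain ⟨θ, hθ⟩ := π.exists_coeff_translate x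
  rw [← integral_mul_left_eq_self (fun y => inner ℂ (π.coeff g f y) (π.coeff g f' y)) x⁻¹]
  congr 1 with y
  have h : (θ y : ℂ) * (starRingEnd ℂ) (θ y : ℂ) = 1 := by
    rw [Complex.mul_conj, Circle.normSq_coe]; simp
  simp only [hθ, RCLike.inner_apply, map_mul]
  linear_combination (π.coeff g f' (x⁻¹ * y) * (starRingEnd ℂ) (π.coeff g f (x⁻¹ * y))) * h

end Algebra

/-! ### Schur's lemma -/

section Schur

variable {G H : Type*} [Group G] [TopologicalSpace G]
  [NormedAddCommGroup H] [InnerProductSpace ℂ H] {π : ProjectiveUnitaryRep G H}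

/-- The kernel of an operator commuting with an irreducible representation is trivial. -/
theorem IsIrreducible.eq_zero_or_injective (hirr : π.IsIrreducible) (T : H →L[ℂ] H)
    (hT : ∀ x v, T (π.toFun x v) = π.toFun x (T v)) : T = 0 ∨ ∀ v, T v = 0 → v = 0 := by
  rcases hirr (LinearMap.ker T.toLinearMap) T.isClosed_ker (fun x v hv => by
    rw [LinearMap.mem_ker] at hv ⊢
    change T v = 0 at hv
    change T (π.toFun x v) = 0
    rw [hT, hv, map_zero]) with h | h
  · right
    intro v hv
    have : v ∈ LinearMap.ker T.toLinearMap := hv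
    rwa [h, Submodule.mem_bot] at this
  · left
    ext v
    have : v ∈ LinearMap.ker T.toLinearMap := by rw [h]; trivial
    exact this

/-- Schur's lemma for self-adjoint operators. -/
theorem IsIrreducible.exists_eq_smul_of_isSelfAdjoint [CompleteSpace H] [Nontrivial H]
    (hirr : π.IsIrreducible)
    (T : H →L[ℂ] H) (hsa : IsSelfAdjoint T) (hT : ∀ x v, T (π.toFun x v) = π.toFun x (T v)) :
    ∃ c : ℝ, ∀ v, T v = (c : ℂ) • v := by
  have hcomm : ∀ f : ℝ → ℝ, ∀ x v, cfc f T (π.toFun x v) = π.toFun x (cfc f T v) := by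
    intro f x v
    have h : Commute T ((π.toFun x).toContinuousLinearEquiv : H →L[ℂ] H) := by
      ext w
      exact hT x w
    have h2 := h.cfc_real f
    exact congrArg (fun S : H →L[ℂ] H => S v) h2.eq
  obtain ⟨a, ha⟩ := ContinuousFunctionalCalculus.spectrum_nonempty (R := ℝ) T hsa
  -- Two spectral points b < c would give nonzero functions of T living on either side of the
  -- midpoint m. Their product is 0, but the first one is injective by irreducibility.
  have key : ∀ b ∈ spectrum ℝ T, ∀ c ∈ spectrum ℝ T, ¬ b < c := by
    intro b hb c hc hbc
    let m := (b + c) / 2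
    have hmul : cfc (fun t : ℝ => max 0 (m - t)) T * cfc (fun t : ℝ => max 0 (t - m)) T = 0 := by
      rw [← cfc_mul (fun t : ℝ => max 0 (m - t)) (fun t : ℝ => max 0 (t - m)) T]
      convert cfc_zero ℝ T using 2
      ext t
      rcases le_total t m with h | h
      · simp [h]
      · simp [h]
    have h1 : cfc (fun t : ℝ => max 0 (m - t)) T ≠ 0 := by
      intro h
      rw [← cfc_zero ℝ T] at h
      have h3 := eqOn_of_cfc_eq_cfc h
      have := h3 hb
      simp only [Pi.zero_apply, max_eq_left_iff, m] at this
      linarith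
    have h2 : cfc (fun t : ℝ => max 0 (t - m)) T ≠ 0 := by
      intro h
      rw [← cfc_zero ℝ T] at h
      have h3 := eqOn_of_cfc_eq_cfc h
      have := h3 hc
      simp only [Pi.zero_apply, max_eq_left_iff, m] at this
      linarith
    apply h2
    ext v
    refine (hirr.eq_zero_or_injective _ (hcomm _)).resolve_left h1 _ ?_
    exact congrArg (fun S : H →L[ℂ] H => S v) hmul
  refine ⟨a, fun v => ?_⟩
  have h : T = algebraMap ℝ (H →L[ℂ] H) a := by
    rw [← cfc_const a T, ← cfc_id' ℝ T]
    conv_rhs => rw [cfc_id' ℝ T]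
    refine cfc_congr fun t ht => ?_
    exact le_antisymm (not_lt.1 (key a ha t ht)) (not_lt.1 (key t ht a ha))
  rw [h, Algebra.algebraMap_eq_smul_one]
  simp

end Schur

/-! ### Orthogonality relations and existence of the formal degree -/

section FormalDegree

variable {G H : Type*} [Group G] [TopologicalSpace G] [MeasurableSpace G]
  [NormedAddCommGroup H] [InnerProductSpace ℂ H] (π : ProjectiveUnitaryRep G H)
  (μ : Measure G)

/-- The graph of the unbounded operator `f ↦ ⟨π(·) g, f⟩` from `H` to `L²(G)`. -/
noncomputable def coeffGraph (g : H) : Submodule ℂ (WithLp 2 (H × Lp ℂ 2 μ)) where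
  carrier := {p | (p.snd : G → ℂ) =ᵐ[μ] π.coeff g p.fst}
  add_mem' {p q} hp hq := by
    simp only [mem_ofPred_eq] at hp hq ⊢
    filter_upwards [hp, hq, Lp.coeFn_add p.snd q.snd] with y h1 h2 h3
    rw [WithLp.add_snd, h3, Pi.add_apply, h1, h2]
    simp [coeff]
  zero_mem' := by
    simp only [mem_ofPred_eq]
    filter_upwards [Lp.coeFn_zero ℂ 2 μ] with y h
    rw [WithLp.zero_snd, h]
    simp [coeff]
  smul_mem' c p hp := by
    simp only [mem_ofPred_eq] at hp ⊢
    filter_upwards [hp, Lp.coeFn_smul c p.snd] with y h1 h2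
    rw [WithLp.smul_snd, h2, Pi.smul_apply, h1]
    simp [coeff]

theorem mem_coeffGraph {g : H} {p : WithLp 2 (H × Lp ℂ 2 μ)} :
    p ∈ π.coeffGraph μ g ↔ (p.snd : G → ℂ) =ᵐ[μ] π.coeff g p.fst := Iff.rfl

/-- L² convergence gives a.e. convergence along a subsequence, while coefficients converge pointwise
in f. -/
theorem isClosed_coeffGraph (g : H) :
    IsClosed (π.coeffGraph μ g : Set (WithLp 2 (H × Lp ℂ 2 μ))) := by
  refine IsSeqClosed.isClosed fun p q hp hpq => ?_
  have h1 : Tendsto (fun n => (p n).fst) atTop (𝓝 q.fst) :=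
    ((WithLp.fstL 2 ℂ H (Lp ℂ 2 μ)).continuous.tendsto q).comp hpq
  have h2 : Tendsto (fun n => (p n).snd) atTop (𝓝 q.snd) :=
    ((WithLp.sndL 2 ℂ H (Lp ℂ 2 μ)).continuous.tendsto q).comp hpq
  obtain ⟨φ, hφ, hae⟩ := (tendstoInMeasure_of_tendsto_Lp h2).exists_seq_tendsto_ae
  have hp' : ∀ᵐ y ∂μ, ∀ n, (p n).snd y = π.coeff g (p n).fst y :=
    ae_all_iff.2 fun n => hp n
  rw [SetLike.mem_coe, mem_coeffGraph]
  filter_upwards [hae, hp'] with y hy hpy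
  refine tendsto_nhds_unique hy ?_
  simp only [hpy]
  exact tendsto_const_nhds.inner (h1.comp hφ.tendsto_atTop)

theorem mem_coeffGraph_toLp {g f : H} (h : MemLp (π.coeff g f) 2 μ) :
    WithLp.toLp 2 (f, h.toLp) ∈ π.coeffGraph μ g := h.coeFn_toLp

theorem memLp_of_mem_coeffGraph {g : H} {p : WithLp 2 (H × Lp ℂ 2 μ)}
    (hp : p ∈ π.coeffGraph μ g) : MemLp (π.coeff g p.fst) 2 μ :=
  (memLp_congr_ae hp).1 (Lp.memLp p.snd)

theorem inner_of_mem_coeffGraph {g : H} {p q : WithLp 2 (H × Lp ℂ 2 μ)}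
    (hp : p ∈ π.coeffGraph μ g) (hq : q ∈ π.coeffGraph μ g) :
    inner ℂ p q = inner ℂ p.fst q.fst
      + ∫ y, inner ℂ (π.coeff g p.fst y) (π.coeff g q.fst y) ∂μ := by
  rw [WithLp.prod_inner_apply]
  congr 1
  rw [L2.inner_def]
  refine integral_congr_ae ?_
  filter_upwards [hp, hq] with y h1 h2
  change inner ℂ (p.snd y) (q.snd y) = _
  rw [h1, h2]

variable [BorelSpace G] [IsTopologicalGroup G]

theorem memLp_coeff_translate [μ.IsMulLeftInvariant] {g f : H} (h : MemLp (π.coeff g f) 2 μ)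
    (x : G) : MemLp (π.coeff g (π.toFun x f)) 2 μ := by
  rw [memLp_coeff] at h ⊢
  rwa [lintegral_coeff_translate]

variable [CompleteSpace H] {π}

/-- The coefficient map may a priori be unbounded, so Schur's lemma is applied to j j†, where j
projects its graph, a Hilbert space, to `H`. This operator is a scalar c, nonzero because f₀ lies in
the image of j. Hence j is onto and all coefficients are square-integrable. -/
theorem IsIrreducible.exists_lintegral_coeff_eq [μ.IsMulLeftInvariant]
    (hirr : π.IsIrreducible) {g f₀ : H} (hf₀ : f₀ ≠ 0) (h₀ : MemLp (π.coeff g f₀) 2 μ) :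
    ∃ C : ℝ, ∀ f, ∫⁻ y, ‖π.coeff g f y‖ₑ ^ 2 ∂μ = ENNReal.ofReal (C * ‖f‖ ^ 2) := by
  have : Nontrivial H := ⟨f₀, 0, hf₀⟩
  let Γ := π.coeffGraph μ g
  have : CompleteSpace Γ := (π.isClosed_coeffGraph μ g).completeSpace_coe
  let j : Γ →L[ℂ] H := (WithLp.fstL 2 ℂ H (Lp ℂ 2 μ)).comp Γ.subtypeL
  let jad : H →L[ℂ] Γ := ContinuousLinearMap.adjoint j
  -- the image of `v` under `j j†`, characterized by a variational identity
  have hmem : ∀ p : Γ, MemLp (π.coeff g (j p)) 2 μ := fun p =>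
    π.memLp_of_mem_coeffGraph μ p.2
  have hin : ∀ p q : Γ, inner ℂ p q
      = inner ℂ (j p) (j q) + ∫ y, inner ℂ (π.coeff g (j p) y) (π.coeff g (j q) y) ∂μ :=
    fun p q => π.inner_of_mem_coeffGraph μ p.2 q.2
  let T : H →L[ℂ] H := j.comp jad
  have hT : ∀ x v, T (π.toFun x v) = π.toFun x (T v) := by
    intro x v
    let q : Γ := ⟨_, π.mem_coeffGraph_toLp μ (π.memLp_coeff_translate μ (hmem (jad v)) x)⟩
    have hq : j q = π.toFun x (T v) := rfl
    suffices h : jad (π.toFun x v) = q by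
      change j (jad (π.toFun x v)) = _
      rw [h, hq]
    -- Writing the first component of p as π(x)w, both inner products reduce to ⟨w, v⟩.
    refine ext_inner_left ℂ fun p => ?_
    obtain ⟨w, hw⟩ := π.exists_eq_toFun x (j p)
    have hwm : MemLp (π.coeff g w) 2 μ := by
      have := hmem p
      rwa [hw, memLp_coeff, lintegral_coeff_translate, ← memLp_coeff] at this
    let r : Γ := ⟨_, π.mem_coeffGraph_toLp μ hwm⟩
    have hr : j r = w := rfl
    have e1 : inner ℂ p (jad (π.toFun x v)) = inner ℂ w v := by
      rw [ContinuousLinearMap.adjoint_inner_right, hw]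
      exact LinearIsometryEquiv.inner_map_map _ _ _
    have e2 : inner ℂ r (jad v) = inner ℂ w v := by
      rw [ContinuousLinearMap.adjoint_inner_right, hr]
    rw [e1, ← e2, hin, hin, hq, hr, hw, integral_conj_coeff_translate]
    congr 1
    exact (LinearIsometryEquiv.inner_map_map _ _ _).symm
  have hsa : IsSelfAdjoint T := by
    rw [ContinuousLinearMap.isSelfAdjoint_iff']
    simp only [T, jad, ContinuousLinearMap.adjoint_comp, ContinuousLinearMap.adjoint_adjoint]
  obtain ⟨c, hc⟩ := hirr.exists_eq_smul_of_isSelfAdjoint T hsa hT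
  have hc0 : (c : ℂ) ≠ 0 := by
    intro h0
    have hz : ∀ v, jad v = 0 := fun v => by
      rw [← inner_self_eq_zero (𝕜 := ℂ), ContinuousLinearMap.adjoint_inner_left]
      change inner ℂ v (T v) = 0
      rw [hc, h0, zero_smul, inner_zero_right]
    let p : Γ := ⟨_, π.mem_coeffGraph_toLp μ h₀⟩
    have hp : j p = f₀ := rfl
    have := ContinuousLinearMap.adjoint_inner_right j p f₀
    change inner ℂ p (jad f₀) = _ at this
    rw [hz, inner_zero_right, hp] at this
    exact hf₀ (inner_self_eq_zero.1 this.symm)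
  -- The graph norm satisfies ‖f‖² + ‖coefficient‖² = c⁻¹‖f‖².
  refine ⟨c⁻¹ - 1, fun f => ?_⟩
  let p : Γ := (c : ℂ)⁻¹ • jad f
  have hp : j p = f := by
    change j ((c : ℂ)⁻¹ • jad f) = f
    rw [map_smul]
    change (c : ℂ)⁻¹ • T f = f
    rw [hc, smul_smul, inv_mul_cancel₀ hc0, one_smul]
  have hpp : inner ℂ p p = (c : ℂ)⁻¹ * inner ℂ f f := by
    change inner ℂ p ((c : ℂ)⁻¹ • jad f) = _
    refine (inner_smul_right (𝕜 := ℂ) p (jad f) (c : ℂ)⁻¹).trans ?_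
    rw [ContinuousLinearMap.adjoint_inner_right, hp]
  have hL := hmem p
  rw [hin, hp] at hpp
  rw [hp] at hL
  have hre : ∫ y, ‖π.coeff g f y‖ ^ 2 ∂μ = (c⁻¹ - 1) * ‖f‖ ^ 2 := by
    have h3 : ∫ y, inner ℂ (π.coeff g f y) (π.coeff g f y) ∂μ
        = ((∫ y, ‖π.coeff g f y‖ ^ 2 ∂μ : ℝ) : ℂ) := by
      rw [← integral_complex_ofReal]
      congr 1 with y
      rw [inner_self_eq_norm_sq_to_K]
      simp
    rw [h3, inner_self_eq_norm_sq_to_K] at hpp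
    have h4 : ((∫ y, ‖π.coeff g f y‖ ^ 2 ∂μ : ℝ) : ℂ) = (((c⁻¹ - 1) * ‖f‖ ^ 2 : ℝ) : ℂ) := by
      push_cast
      linear_combination hpp
    exact_mod_cast h4
  rw [← hre, ofReal_integral_eq_lintegral_ofReal (hL.integrable_norm_pow two_ne_zero)
    (ae_of_all _ fun y => by positivity)]
  congr 1 with y
  rw [ENNReal.ofReal_pow (norm_nonneg _), ofReal_norm]

/-- Orthogonality relations: an irreducible square-integrable representation of a unimodular group
has a formal degree. -/
theorem IsIrreducible.exists_isFormalDegree [LocallyCompactSpace G] [SecondCountableTopology G]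
    [μ.IsHaarMeasure] [μ.IsMulRightInvariant]
    (hirr : π.IsIrreducible) (hsq : π.IsSquareIntegrable μ) : ∃ d, π.IsFormalDegree μ d := by
  have : μ.IsInvInvariant := isInvInvariant_of_isMulRightInvariant μ
  obtain ⟨g, hg0, hg⟩ := hsq
  simp only [enorm_inner_eq_coeff] at hg
  have hgg : MemLp (π.coeff g g) 2 μ := (π.memLp_coeff μ g g).2 hg
  obtain ⟨C, hC⟩ := hirr.exists_lintegral_coeff_eq μ hg0 hgg
  have hn : 0 < ‖g‖ := norm_pos_iff.2 hg0
  have hpos : 0 < ∫⁻ y, ‖π.coeff g g y‖ₑ ^ 2 ∂μ := by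
    have hc : Continuous fun y => ‖π.coeff g g y‖ₑ ^ 2 :=
      (ENNReal.continuous_pow 2).comp (π.continuous_coeff g g).enorm
    rw [lintegral_pos_iff_support hc.measurable]
    refine (isOpen_ne_fun hc continuous_const).measure_pos μ ⟨1, ?_⟩
    simp only [mem_ofPred_eq, ← ofReal_norm, norm_coeff_one]
    refine pow_ne_zero 2 (ENNReal.ofReal_pos.2 (norm_pos_iff.2 ?_)).ne'
    exact inner_self_ne_zero.2 hg0
  have hCpos : 0 < C := by
    rw [hC, ENNReal.ofReal_pos] at hpos
    exact pos_of_mul_pos_left hpos (by positivity)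
  -- For another window h with constant D, swapping the roles of g and h by inversion gives D‖g‖² =
  -- C‖h‖²; this fixes the dependence of D on h.
  refine ⟨(C / ‖g‖ ^ 2)⁻¹, by positivity, fun f h => ?_⟩
  simp only [enorm_inner_eq_coeff, inv_inv]
  have hhg : ∫⁻ y, ‖π.coeff h g y‖ₑ ^ 2 ∂μ = ENNReal.ofReal (C * ‖h‖ ^ 2) := by
    rw [lintegral_coeff_swap, hC]
  obtain ⟨D, hD⟩ := hirr.exists_lintegral_coeff_eq μ hg0
    ((π.memLp_coeff μ h g).2 (hhg ▸ ENNReal.ofReal_lt_top))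
  rw [hD]
  rw [hD] at hhg
  by_cases hh : h = 0
  · have h2 := hD f
    subst hh
    rw [← h2]
    simp [coeff]
  have hhn : 0 < ‖h‖ := norm_pos_iff.2 hh
  have hDpos : 0 < D := by
    have : 0 < ENNReal.ofReal (D * ‖g‖ ^ 2) := by rw [hhg, ENNReal.ofReal_pos]; positivity
    rw [ENNReal.ofReal_pos] at this
    exact pos_of_mul_pos_left this (by positivity)
  rw [ENNReal.ofReal_eq_ofReal_iff (by positivity) (by positivity)] at hhg
  congr 1
  field_simp
  linear_combination ‖f‖ ^ 2 * hhg

theorem IsIrreducible.isFormalDegree_formalDegree [LocallyCompactSpace G] [SecondCountableTopology G]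
    [μ.IsHaarMeasure] [μ.IsMulRightInvariant] (hirr : π.IsIrreducible) (hsq : π.IsSquareIntegrable μ) :
    π.IsFormalDegree μ (π.formalDegree μ) := by
  obtain ⟨d, hd⟩ := hirr.exists_isFormalDegree μ hsq
  obtain ⟨g, hg, -⟩ := hsq
  have : Nontrivial H := ⟨g, 0, hg⟩
  rwa [hd.formalDegree_eq]

end FormalDegree

end ProjectiveUnitaryRep

/-! ### Finite Riesz sequences and projections -/

section Hilbert

variable {H : Type*} [NormedAddCommGroup H] [InnerProductSpace ℂ H]

/-- Bessel-type bound for the projection onto the span of a finite Riesz sequence. -/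
theorem norm_sq_starProjection_span_le {κ : Type*} [Fintype κ] {g : κ → H} {A : ℝ} (hA : 0 < A)
    (hlow : ∀ c : κ → ℂ, A * ∑ i, ‖c i‖ ^ 2 ≤ ‖∑ i, c i • g i‖ ^ 2)
    (W : Submodule ℂ H) [W.HasOrthogonalProjection] (hW : W = Submodule.span ℂ (range g)) (v : H) :
    A * ‖W.starProjection v‖ ^ 2 ≤ ∑ i, ‖inner ℂ (g i) v‖ ^ 2 := by
  set p := W.starProjection v with hp
  obtain ⟨c, hc⟩ := (Submodule.mem_span_range_iff_exists_fun ℂ).1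
    (hW.le (Submodule.starProjection_apply_mem W v))
  have h1 : ‖p‖ ^ 2 = ‖∑ i, starRingEnd ℂ (c i) * inner ℂ (g i) v‖ := by
    have e : inner ℂ p v = inner ℂ p p := by
      rw [hp, Submodule.inner_starProjection_left_eq_right]
      conv_lhs => rw [← Submodule.starProjection_eq_self_iff.2
        (Submodule.starProjection_apply_mem W v)]
      rw [Submodule.inner_starProjection_left_eq_right]
    have e2 : inner ℂ p v = ∑ i, starRingEnd ℂ (c i) * inner ℂ (g i) v := by
      rw [hp, ← hc, sum_inner]
      simp [inner_smul_left]
    rw [← e2, e, inner_self_eq_norm_sq_to_K]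
    simp
  have h2 : ‖p‖ ^ 2 ≤ ∑ i, ‖c i‖ * ‖inner ℂ (g i) v‖ := by
    rw [h1]
    refine (norm_sum_le _ _).trans (le_of_eq ?_)
    simp
  -- Cauchy–Schwarz gives ‖p‖⁴ ≤ ‖c‖² s, and the lower bound gives A‖c‖² ≤ ‖p‖²; then ‖p‖² is
  -- cancelled.
  have h3 := Finset.sum_mul_sq_le_sq_mul_sq Finset.univ (fun i => ‖c i‖)
    fun i => ‖inner ℂ (g i) v‖
  have h4 := hlow c
  rw [hc, ← hp] at h4
  set s := ∑ i, ‖inner ℂ (g i) v‖ ^ 2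
  have hs : 0 ≤ s := Finset.sum_nonneg fun i _ => by positivity
  rcases eq_or_lt_of_le (sq_nonneg ‖p‖) with h0 | h0
  · rw [← h0, mul_zero]; exact hs
  have h5 : (‖p‖ ^ 2) ^ 2 ≤ (∑ i, ‖c i‖ ^ 2) * s :=
    (pow_le_pow_left₀ (sq_nonneg _) h2 2).trans h3
  have h6 : A * (‖p‖ ^ 2) ^ 2 ≤ ‖p‖ ^ 2 * s := by
    calc A * (‖p‖ ^ 2) ^ 2 ≤ A * ((∑ i, ‖c i‖ ^ 2) * s) := by gcongr
      _ = (A * ∑ i, ‖c i‖ ^ 2) * s := by ring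
      _ ≤ ‖p‖ ^ 2 * s := by gcongr
  refine le_of_mul_le_mul_left ?_ h0
  linarith [h6]

theorem finrank_span_range_of_lower_bound {κ : Type*} [Fintype κ] {g : κ → H} {A : ℝ} (hA : 0 < A)
    (hlow : ∀ c : κ → ℂ, A * ∑ i, ‖c i‖ ^ 2 ≤ ‖∑ i, c i • g i‖ ^ 2) :
    Module.finrank ℂ (Submodule.span ℂ (range g)) = Fintype.card κ := by
  refine finrank_span_eq_card (Fintype.linearIndependent_iff.2 fun c hc i => ?_)
  have h := hlow c
  rw [hc, norm_zero, zero_pow two_ne_zero] at h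
  have h2 : ∑ i, ‖c i‖ ^ 2 ≤ 0 := nonpos_of_mul_nonpos_right h hA
  have h3 := (Finset.sum_eq_zero_iff_of_nonneg fun i _ => sq_nonneg ‖c i‖).1
    (h2.antisymm (Finset.sum_nonneg fun i _ => sq_nonneg ‖c i‖)) i (Finset.mem_univ i)
  simpa using h3

theorem enorm_sq_starProjection_eq_sum (W : Submodule ℂ H) [FiniteDimensional ℂ W] (v : H) :
    ‖W.starProjection v‖ₑ ^ 2 = ∑ i, ‖inner ℂ v (stdOrthonormalBasis ℂ W i : H)‖ₑ ^ 2 := by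
  have h := (stdOrthonormalBasis ℂ W).sum_sq_norm_inner_left (W.orthogonalProjectionOnto v)
  have h2 : ∀ i, inner ℂ (W.orthogonalProjectionOnto v) (stdOrthonormalBasis ℂ W i)
      = inner ℂ v (stdOrthonormalBasis ℂ W i : H) := fun i => by
    rw [Submodule.coe_inner]
    exact Submodule.inner_starProjection_left_eq_right .. |>.trans
      (by rw [Submodule.starProjection_eq_self_iff.2 (Subtype.coe_prop _)])
  simp only [h2] at h
  have h3 : ‖W.starProjection v‖ = ‖W.orthogonalProjectionOnto v‖ := rfl
  rw [← ofReal_norm, ← ENNReal.ofReal_pow (norm_nonneg _), h3, ← h,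
    ENNReal.ofReal_sum_of_nonneg fun i _ => by positivity]
  refine Finset.sum_congr rfl fun i _ => ?_
  rw [ENNReal.ofReal_pow (norm_nonneg _), ofReal_norm]

end Hilbert

/-- The tail of a finite integral is small off a compact set. -/
theorem exists_isCompact_setLIntegral_compl_le {X : Type*} [TopologicalSpace X] [T2Space X]
    [SigmaCompactSpace X] [MeasurableSpace X] [BorelSpace X] (μ : Measure X) {φ : X → ℝ≥0∞}
    (hφ : ∫⁻ x, φ x ∂μ < ∞) {δ : ℝ≥0∞} (hδ : 0 < δ) :
    ∃ L : Set X, IsCompact L ∧ ∫⁻ x in Lᶜ, φ x ∂μ ≤ δ := by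
  let ν := μ.withDensity φ
  have hms : ∀ n, MeasurableSet (compactCovering X n)ᶜ := fun n =>
    (isCompact_compactCovering X n).measurableSet.compl
  have hν : ∀ s, MeasurableSet s → ν s = ∫⁻ x in s, φ x ∂μ := fun s hs => withDensity_apply φ hs
  have ht := tendsto_measure_iInter_atTop (μ := ν) (s := fun n => (compactCovering X n)ᶜ)
    (fun n => (hms n).nullMeasurableSet)
    (fun m n h => compl_subset_compl.2 (compactCovering_subset X h))
    ⟨0, ne_top_of_le_ne_top hφ.ne (by rw [hν _ (hms 0)]; exact setLIntegral_le_lintegral _ _)⟩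
  rw [← compl_iUnion, iUnion_compactCovering, compl_univ, measure_empty] at ht
  obtain ⟨n, hn⟩ := (ht.eventually (gt_mem_nhds hδ)).exists
  refine ⟨compactCovering X n, isCompact_compactCovering X n, ?_⟩
  rw [← hν _ (hms n)]
  exact hn.le

namespace ProjectiveUnitaryRep

/-! ### The trace identity -/

section Trace

variable {G H : Type*} [Group G] [TopologicalSpace G] [MeasurableSpace G]
  [NormedAddCommGroup H] [InnerProductSpace ℂ H] {π : ProjectiveUnitaryRep G H}
  {μ : Measure G} {d : ℝ}

theorem IsFormalDegree.lintegral_coeff (hd : π.IsFormalDegree μ d) (f g : H) :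
    ∫⁻ y, ‖π.coeff g f y‖ₑ ^ 2 ∂μ = ENNReal.ofReal (d⁻¹ * ‖f‖ ^ 2 * ‖g‖ ^ 2) := by
  rw [← hd.2 f g]
  simp only [enorm_inner_eq_coeff]

variable [BorelSpace G]

theorem measurable_enorm_coeff_sq (π : ProjectiveUnitaryRep G H) (g f : H) :
    Measurable fun y => ‖π.coeff g f y‖ₑ ^ 2 :=
  ((ENNReal.continuous_pow 2).comp (π.continuous_coeff g f).enorm).measurable

/-- The orthogonality relations say that the rank-one projections onto π(y)η integrate weakly to d⁻¹
times the identity; this is the trace of that identity compressed to W. -/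
theorem IsFormalDegree.lintegral_enorm_sq_starProjection (hd : π.IsFormalDegree μ d)
    (W : Submodule ℂ H) [FiniteDimensional ℂ W] {η : H} (hη : ‖η‖ = 1) :
    ∫⁻ y, ‖W.starProjection (π.toFun y η)‖ₑ ^ 2 ∂μ
      = Module.finrank ℂ W * ENNReal.ofReal d⁻¹ := by
  simp only [enorm_sq_starProjection_eq_sum]
  refine (lintegral_finsetSum _ fun i _ =>
    π.measurable_enorm_coeff_sq η (stdOrthonormalBasis ℂ W i : H)).trans ?_
  have h : ∀ i, ∫⁻ y, ‖inner ℂ (π.toFun y η) (stdOrthonormalBasis ℂ W i : H)‖ₑ ^ 2 ∂μ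
      = ENNReal.ofReal d⁻¹ := fun i => by
    refine (hd.lintegral_coeff (stdOrthonormalBasis ℂ W i : H) η).trans ?_
    have : ‖(stdOrthonormalBasis ℂ W i : H)‖ = 1 := (stdOrthonormalBasis ℂ W).norm_eq_one i
    rw [this, hη]
    simp
  exact (Finset.sum_congr rfl fun i _ => h i).trans (by simp)

end Trace

/-! ### Counting points of a Riesz sequence -/

section Riesz

variable {G H : Type*} [Group G] [TopologicalSpace G]
  [NormedAddCommGroup H] [InnerProductSpace ℂ H] {π : ProjectiveUnitaryRep G H}
  {Λ : Set G} {g : H}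

theorem IsRieszSequence.exists_lower_bound (h : π.IsRieszSequence Λ g) :
    ∃ A : ℝ, 0 < A ∧ ∀ (F : Finset Λ) (c : F → ℂ),
      A * ∑ i, ‖c i‖ ^ 2 ≤ ‖∑ i, c i • π.toFun (i : Λ) g‖ ^ 2 := by
  classical
  obtain ⟨A, B, hA, -, h⟩ := h
  refine ⟨A, hA, fun F c => ?_⟩
  let f : Λ → ℂ := fun l => if hl : l ∈ F then c ⟨l, hl⟩ else 0
  have hf : ∀ i : F, f i = c i := fun i => by simp [f]
  let v : lp (fun _ : Λ => ℂ) 2 := ∑ i ∈ F, lp.single 2 i (f i)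
  have hv : ∀ l, v l = f l := by
    intro l
    simp only [v, lp.coeFn_sum, Finset.sum_apply, lp.single_apply]
    by_cases hl : l ∈ F
    · rw [Finset.sum_eq_single_of_mem l hl]
      · simp
      · intro b _ hb
        simp [hb.symm]
    · rw [Finset.sum_eq_zero]
      · simp [f, hl]
      · intro b hb
        have : l ≠ b := fun h => hl (h ▸ hb)
        simp [this]
  have hn : ‖v‖ ^ 2 = ∑ i, ‖c i‖ ^ 2 := by
    have := lp.norm_sum_single (p := 2) (by norm_num) f F
    simp only [ENNReal.toReal_ofNat, Real.rpow_ofNat] at this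
    rw [this, ← Finset.sum_coe_sort]
    simp only [hf]
  have hs : ∑' l : Λ, v l • π.toFun l g = ∑ i, c i • π.toFun (i : Λ) g := by
    rw [tsum_eq_sum (s := F), ← Finset.sum_coe_sort]
    · simp only [hv, hf]
    · intro l hl
      simp [hv, f, hl]
  rw [← hn, ← hs]
  exact (h v).2.1

variable [IsTopologicalGroup G] [T2Space G]
  [MeasurableSpace G] [BorelSpace G] {μ : Measure G} {d : ℝ}

/-- If x ∈ K and y ∉ KL, then x⁻¹y ∉ L, so translation by x moves the domain into the complement of
L. -/
theorem setLIntegral_coeff_translate_le [μ.IsMulLeftInvariant] (η f : H) {K L : Set G}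
    (hL : IsCompact L) (hK : IsCompact K) {x : G} (hx : x ∈ K) :
    ∫⁻ y in (K * L)ᶜ, ‖π.coeff η (π.toFun x f) y‖ₑ ^ 2 ∂μ
      ≤ ∫⁻ y in Lᶜ, ‖π.coeff η f y‖ₑ ^ 2 ∂μ := by
  rw [← lintegral_indicator (hK.mul hL).measurableSet.compl,
    ← lintegral_indicator hL.measurableSet.compl,
    ← lintegral_mul_left_eq_self (Lᶜ.indicator fun y => ‖π.coeff η f y‖ₑ ^ 2) x⁻¹]
  refine lintegral_mono fun y => ?_
  by_cases hy : y ∈ (K * L)ᶜ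
  · have hy' : x⁻¹ * y ∈ Lᶜ := fun h => hy ⟨x, hx, x⁻¹ * y, h, by simp⟩
    rw [indicator_of_mem hy, indicator_of_mem hy', ← ofReal_norm, ← ofReal_norm,
      norm_coeff_translate]
  · rw [indicator_of_notMem hy]
    exact zero_le

/-- The number of elements of a Riesz sequence in a compact set is controlled by the measure of a
thickening of this set. -/
theorem IsFormalDegree.card_mul_le_of_riesz [μ.IsMulLeftInvariant]
    (hd : π.IsFormalDegree μ d) {A : ℝ} (hA : 0 < A) (F : Finset Λ)
    (hlow : ∀ c : F → ℂ, A * ∑ i, ‖c i‖ ^ 2 ≤ ‖∑ i, c i • π.toFun (i : Λ) g‖ ^ 2)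
    {K L : Set G} (hK : IsCompact K) (hL : IsCompact L) (hF : ∀ i ∈ F, (i : G) ∈ K)
    {η : H} (hη : ‖η‖ = 1) :
    F.card * ENNReal.ofReal d⁻¹ ≤ μ (K * L)
      + F.card * ((ENNReal.ofReal A)⁻¹ * ∫⁻ y in Lᶜ, ‖π.coeff η g y‖ₑ ^ 2 ∂μ) := by
  set W := Submodule.span ℂ (range fun i : F => π.toFun (i : Λ) g) with hW
  have hfd : FiniteDimensional ℂ W := FiniteDimensional.span_of_finite ℂ (finite_range _)
  have hA0 : ENNReal.ofReal A ≠ 0 := (ENNReal.ofReal_pos.2 hA).ne'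
  have hrank : Module.finrank ℂ W = F.card := by
    rw [hW, finrank_span_range_of_lower_bound hA hlow, Fintype.card_coe]
  have htr := hd.lintegral_enorm_sq_starProjection W hη
  rw [hrank, ← lintegral_add_compl _ (hK.mul hL).measurableSet] at htr
  rw [← htr]
  gcongr
  · calc ∫⁻ y in K * L, ‖W.starProjection (π.toFun y η)‖ₑ ^ 2 ∂μ
        ≤ ∫⁻ y in K * L, 1 ∂μ := by
          refine lintegral_mono fun y => ?_
          have : ‖W.starProjection (π.toFun y η)‖ ≤ 1 := by
            refine (W.norm_starProjection_apply_le _).trans ?_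
            rw [LinearIsometryEquiv.norm_map, hη]
          rw [← ofReal_norm]
          exact pow_le_one₀ zero_le (ENNReal.ofReal_le_one.2 this)
      _ = μ (K * L) := by simp
  · calc ∫⁻ y in (K * L)ᶜ, ‖W.starProjection (π.toFun y η)‖ₑ ^ 2 ∂μ
        ≤ ∫⁻ y in (K * L)ᶜ, (ENNReal.ofReal A)⁻¹ *
            ∑ i : F, ‖π.coeff η (π.toFun (i : Λ) g) y‖ₑ ^ 2 ∂μ := by
          refine lintegral_mono fun y => ?_
          have h := norm_sq_starProjection_span_le hA hlow W hW (π.toFun y η)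
          rw [mul_comm, ← div_eq_mul_inv, ENNReal.le_div_iff_mul_le (Or.inl hA0)
            (Or.inl ENNReal.ofReal_ne_top), mul_comm]
          have h2 := ENNReal.ofReal_le_ofReal h
          rw [ENNReal.ofReal_mul hA.le, ENNReal.ofReal_pow (norm_nonneg _), ofReal_norm,
            ENNReal.ofReal_sum_of_nonneg fun i _ => by positivity] at h2
          refine h2.trans (le_of_eq (Finset.sum_congr rfl fun i _ => ?_))
          rw [ENNReal.ofReal_pow (norm_nonneg _), ofReal_norm, enorm_inner_eq_coeff]
      _ = (ENNReal.ofReal A)⁻¹ *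
            ∑ i : F, ∫⁻ y in (K * L)ᶜ, ‖π.coeff η (π.toFun (i : Λ) g) y‖ₑ ^ 2 ∂μ := by
          rw [lintegral_const_mul, lintegral_finsetSum]
          · exact fun i _ => π.measurable_enorm_coeff_sq _ _
          · exact Finset.measurable_sum _ fun i _ => π.measurable_enorm_coeff_sq _ _
      _ ≤ (ENNReal.ofReal A)⁻¹ * ∑ i : F, ∫⁻ y in Lᶜ, ‖π.coeff η g y‖ₑ ^ 2 ∂μ := by
          exact mul_le_mul' le_rfl (Finset.sum_le_sum fun i _ =>
            setLIntegral_coeff_translate_le η g hL hK (hF i i.2))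
      _ = _ := by
          rw [Finset.sum_const, Finset.card_univ, Fintype.card_coe, nsmul_eq_mul]
          ring

/-- If every finite part of a set has at most `N` elements, then so has the set. -/
theorem _root_.Set.encard_mul_le_of_forall_finset {X : Type*} {s t : Set X} {a b : ℝ≥0∞}
    (h : ∀ F : Finset s, (∀ i ∈ F, (i : X) ∈ t) → (F.card : ℝ≥0∞) * a ≤ b) :
    ((s ∩ t).encard : ℝ≥0∞) * a ≤ b := by
  have key : ∀ F : Finset X, (F : Set X) ⊆ s ∩ t → (F.card : ℝ≥0∞) * a ≤ b := by
    intro F hF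
    have := h (F.attach.map ⟨fun i : F => (⟨i, (hF i.2).1⟩ : s), fun i j hij =>
      Subtype.ext (congrArg (fun z : s => (z : X)) hij)⟩) (by
      intro i hi
      simp only [Finset.mem_map, Finset.mem_attach, true_and] at hi
      obtain ⟨j, rfl⟩ := hi
      exact (hF j.2).2)
    simpa using this
  by_cases hfin : (s ∩ t).Finite
  · have := key hfin.toFinset (by simp)
    rwa [hfin.encard_eq_coe_toFinset_card]
  · rw [Set.Infinite.encard_eq hfin]
    by_cases ha : a = 0
    · simp [ha]
    have hb : b = ∞ := by
      refine ENNReal.eq_top_of_forall_nnreal_le fun r => ?_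
      obtain ⟨n, hn⟩ := ENNReal.exists_nat_mul_gt ha (b := (r : ℝ≥0∞)) ENNReal.coe_ne_top
      obtain ⟨F, hF, hc⟩ := Set.Infinite.exists_subset_card_eq hfin n
      exact hn.le.trans (hc ▸ key F hF)
    rw [hb]
    exact le_top

end Riesz

end ProjectiveUnitaryRep

namespace ProjectiveUnitaryRep

/-! ### Upper density of Riesz sequences -/

section RieszDensity

variable {G H : Type*} [Group G] [TopologicalSpace G]
  [NormedAddCommGroup H] [InnerProductSpace ℂ H] {π : ProjectiveUnitaryRep G H}
  {Λ : Set G} {g : H} [IsTopologicalGroup G] [T2Space G] [LocallyCompactSpace G]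
  [SecondCountableTopology G] [MeasurableSpace G] [BorelSpace G] {μ : Measure G} {d : ℝ}

theorem IsFormalDegree.upperBeurlingDensity_le_of_riesz [μ.IsHaarMeasure] [Nontrivial H]
    (hd : π.IsFormalDegree μ d) {K : ℕ → Set G} (hK : IsFolnerSequence μ K)
    (h : π.IsRieszSequence Λ g) : upperBeurlingDensity μ K Λ ≤ ENNReal.ofReal d := by
  obtain ⟨η, hη⟩ := exists_norm_eq H zero_le_one
  obtain ⟨A, hA, hlow⟩ := h.exists_lower_bound
  set D := ENNReal.ofReal d⁻¹ with hD
  have hDinv : D⁻¹ = ENNReal.ofReal d := by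
    rw [hD, ENNReal.ofReal_inv_of_pos hd.1, inv_inv]
  have hD0 : 0 < D := ENNReal.ofReal_pos.2 (inv_pos.2 hd.1)
  have hA0 : ENNReal.ofReal A ≠ 0 := (ENNReal.ofReal_pos.2 hA).ne'
  have key : ∀ δ : ℝ≥0∞, 0 < δ → δ < D → upperBeurlingDensity μ K Λ ≤ (D - δ)⁻¹ := by
    intro δ hδ hδD
    have hδtop : δ ≠ ∞ := ne_top_of_lt hδD
    have hsub0 : D - δ ≠ 0 := (tsub_pos_of_lt hδD).ne'
    have hsubtop : D - δ ≠ ∞ := ENNReal.sub_ne_top ENNReal.ofReal_ne_top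
    have hfin : ∫⁻ y, ‖π.coeff η g y‖ₑ ^ 2 ∂μ < ∞ := by
      rw [hd.lintegral_coeff]; exact ENNReal.ofReal_lt_top
    obtain ⟨L₀, hL₀, htail⟩ := exists_isCompact_setLIntegral_compl_le μ hfin
      (δ := ENNReal.ofReal A * δ) (ENNReal.mul_pos hA0 hδ.ne')
    -- The point 1 only ensures that L is nonempty, as the Følner condition requires.
    set L := insert 1 L₀
    have hL : IsCompact L := hL₀.insert 1
    have htailL : (ENNReal.ofReal A)⁻¹ * ∫⁻ y in Lᶜ, ‖π.coeff η g y‖ₑ ^ 2 ∂μ ≤ δ := by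
      calc _ ≤ (ENNReal.ofReal A)⁻¹ * (ENNReal.ofReal A * δ) := by
            gcongr
            exact (lintegral_mono_set (compl_subset_compl.2 (subset_insert _ _))).trans htail
        _ = δ := by rw [← mul_assoc, ENNReal.inv_mul_cancel hA0 ENNReal.ofReal_ne_top, one_mul]
    have hbound : ∀ (n : ℕ) (x : G), ((Λ ∩ x • K n).encard : ℝ≥0∞) / μ (K n)
        ≤ (D - δ)⁻¹ * (1 + μ (K n ∆ (K n * L)) / μ (K n)) := by
      intro n x
      have hKn := hK.isCompact n
      have hμ0 := (hK.measure_pos n).ne'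
      have hμt : μ (K n) ≠ ∞ := hKn.measure_lt_top.ne
      have h1 : ((Λ ∩ x • K n).encard : ℝ≥0∞) * (D - δ) ≤ μ (K n * L) := by
        -- Finiteness of Λ ∩ xK_n is not known yet. For finite parts the error δ · card is finite
        -- and can be subtracted.
        refine Set.encard_mul_le_of_forall_finset fun F hF => ?_
        have h2 := hd.card_mul_le_of_riesz hA F (hlow F) (hKn.smul x) hL hF hη
        rw [smul_mul_assoc, measure_smul] at h2
        rw [ENNReal.mul_sub fun _ _ => ENNReal.natCast_ne_top _, tsub_le_iff_right]
        refine h2.trans ?_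
        gcongr
      have h3 : μ (K n * L) ≤ μ (K n) + μ (K n ∆ (K n * L)) := by
        refine (measure_mono fun y hy => ?_).trans (measure_union_le _ _)
        by_cases hyK : y ∈ K n
        · exact Or.inl hyK
        · exact Or.inr (Or.inr ⟨hy, hyK⟩)
      calc ((Λ ∩ x • K n).encard : ℝ≥0∞) / μ (K n)
          = (D - δ)⁻¹ * (((Λ ∩ x • K n).encard : ℝ≥0∞) * (D - δ)) / μ (K n) := by
            rw [mul_comm (Set.encard _ : ℝ≥0∞), ← mul_assoc,
              ENNReal.inv_mul_cancel hsub0 hsubtop, one_mul]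
        _ ≤ (D - δ)⁻¹ * (μ (K n) + μ (K n ∆ (K n * L))) / μ (K n) := by
            gcongr
            exact h1.trans h3
        _ = _ := by
            rw [mul_div_assoc, ENNReal.add_div, ENNReal.div_self hμ0 hμt]
    have hlim : Tendsto (fun n => (D - δ)⁻¹ * (1 + μ (K n ∆ (K n * L)) / μ (K n))) atTop
        (𝓝 (D - δ)⁻¹) := by
      have := ENNReal.Tendsto.const_mul (a := (D - δ)⁻¹)
        (tendsto_const_nhds (x := (1 : ℝ≥0∞)) |>.add
          (hK.tendsto_symmDiff L hL (insert_nonempty _ _))) (Or.inr (ENNReal.inv_ne_top.2 hsub0))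
      simpa using this
    rw [upperBeurlingDensity, ← hlim.limsup_eq]
    exact limsup_le_limsup (Eventually.of_forall fun n => iSup_le (hbound n))
  rw [← hDinv]
  have hlim : Tendsto (fun δ : ℝ≥0∞ => (D - δ)⁻¹) (𝓝[>] 0) (𝓝 D⁻¹) := by
    have h1 : Tendsto (fun δ : ℝ≥0∞ => D - δ) (𝓝[>] 0) (𝓝 (D - 0)) :=
      ENNReal.Tendsto.sub tendsto_const_nhds (tendsto_id.mono_left nhdsWithin_le_nhds)
        (Or.inl ENNReal.ofReal_ne_top)
    rw [tsub_zero] at h1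
    exact (continuous_inv.tendsto D).comp h1
  refine ge_of_tendsto hlim ?_
  filter_upwards [self_mem_nhdsWithin, Ioo_mem_nhdsGT hD0] with δ h1 h2
  exact key δ h1 h2.2

end RieszDensity

end ProjectiveUnitaryRep

/-! ### Frames and approximation by finite-dimensional subspaces -/

section HilbertFrame

variable {H ι : Type*} [NormedAddCommGroup H] [InnerProductSpace ℂ H]

theorem lp_two_enorm_sq_eq_tsum (u : lp (fun _ : ι => ℂ) 2) : ‖u‖ₑ ^ 2 = ∑' i, ‖u i‖ₑ ^ 2 := by
  have h0 : 0 < (2 : ℝ≥0∞).toReal := by norm_num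
  have h := lp.norm_rpow_eq_tsum h0 u
  have hs := (memℓp_gen_iff h0).1 (lp.memℓp u)
  simp only [ENNReal.toReal_ofNat, Real.rpow_ofNat] at h hs
  rw [← ofReal_norm, ← ENNReal.ofReal_pow (norm_nonneg _), h,
    ENNReal.ofReal_tsum_of_nonneg (fun i => by positivity) hs]
  simp only [ENNReal.ofReal_pow (norm_nonneg _), ofReal_norm]

theorem enorm_inner_symm (v w : H) : ‖inner ℂ v w‖ₑ = ‖inner ℂ w v‖ₑ := by
  rw [← ofReal_norm, ← ofReal_norm, norm_inner_symm]

/-- The analysis operator of a Bessel family. -/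
theorem exists_analysisOperator {g : ι → H} {B : ℝ}
    (hup : ∀ f : H, ∑' i, ‖inner ℂ f (g i)‖ₑ ^ 2 ≤ ENNReal.ofReal (B * ‖f‖ ^ 2)) :
    ∃ C : H →L[ℂ] lp (fun _ : ι => ℂ) 2, ∀ f i, C f i = inner ℂ (g i) f := by
  have h0 : 0 < (2 : ℝ≥0∞).toReal := by norm_num
  have hup' : ∀ f : H, ∑' i, ‖inner ℂ (g i) f‖ₑ ^ 2 ≤ ENNReal.ofReal (B * ‖f‖ ^ 2) := fun f => by
    simpa only [enorm_inner_symm] using hup f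
  have hmem : ∀ f : H, Memℓp (fun i => inner ℂ (g i) f) 2 := fun f => by
    rw [memℓp_gen_iff h0]
    have := ENNReal.summable_toReal (ne_top_of_le_ne_top ENNReal.ofReal_ne_top (hup' f))
    simpa using this
  let C₀ : H →ₗ[ℂ] lp (fun _ : ι => ℂ) 2 :=
    { toFun := fun f => ⟨fun i => inner ℂ (g i) f, hmem f⟩
      map_add' := fun f f' => by
        ext i
        exact inner_add_right _ _ _
      map_smul' := fun c f => by
        ext i
        exact inner_smul_right _ _ _ }
  refine ⟨C₀.mkContinuous (Real.sqrt |B|) fun f => ?_, fun f i => rfl⟩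
  have h1 : ‖C₀ f‖ₑ ^ 2 ≤ ENNReal.ofReal (|B| * ‖f‖ ^ 2) := by
    rw [lp_two_enorm_sq_eq_tsum]
    refine (hup' f).trans (ENNReal.ofReal_le_ofReal ?_)
    gcongr
    exact le_abs_self B
  rw [← ofReal_norm, ← ENNReal.ofReal_pow (norm_nonneg _),
    ENNReal.ofReal_le_ofReal_iff (by positivity)] at h1
  refine abs_le_of_sq_le_sq' ?_ (by positivity) |>.2
  rw [mul_pow, Real.sq_sqrt (abs_nonneg B)]
  exact h1

variable [CompleteSpace H]

/-- For a frame and a finite set `F` of indices there is a subspace of dimension at most `#F` whose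
distance to a vector is controlled by the frame coefficients outside of `F`. -/
theorem exists_finiteDimensional_approx {g : ι → H} {A B : ℝ} (hA : 0 < A)
    (hlow : ∀ f : H, ENNReal.ofReal (A * ‖f‖ ^ 2) ≤ ∑' i, ‖inner ℂ f (g i)‖ₑ ^ 2)
    (hup : ∀ f : H, ∑' i, ‖inner ℂ f (g i)‖ₑ ^ 2 ≤ ENNReal.ofReal (B * ‖f‖ ^ 2)) (F : Finset ι) :
    ∃ (W : Submodule ℂ H) (_ : FiniteDimensional ℂ W), Module.finrank ℂ W ≤ F.card ∧
      ∀ v, ENNReal.ofReal A * ‖Wᗮ.starProjection v‖ₑ ^ 2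
        ≤ ∑' i, (F : Set ι)ᶜ.indicator (fun i => ‖inner ℂ v (g i)‖ₑ ^ 2) i := by
  classical
  obtain ⟨C, hC⟩ := exists_analysisOperator hup
  have hClow : ∀ f, ENNReal.ofReal A * ‖f‖ₑ ^ 2 ≤ ‖C f‖ₑ ^ 2 := fun f => by
    rw [lp_two_enorm_sq_eq_tsum, ← ofReal_norm, ← ENNReal.ofReal_pow (norm_nonneg _),
      ← ENNReal.ofReal_mul hA.le]
    refine (hlow f).trans (le_of_eq (tsum_congr fun i => ?_))
    rw [hC, enorm_inner_symm]
  have hCreal : ∀ f, A * ‖f‖ ^ 2 ≤ ‖C f‖ ^ 2 := fun f => by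
    have := hClow f
    rwa [← ofReal_norm, ← ofReal_norm, ← ENNReal.ofReal_pow (norm_nonneg _),
      ← ENNReal.ofReal_pow (norm_nonneg _), ← ENNReal.ofReal_mul hA.le,
      ENNReal.ofReal_le_ofReal_iff (by positivity)] at this
  have hanti : AntilipschitzWith (Real.toNNReal (Real.sqrt A)⁻¹) C := by
    refine C.antilipschitz_of_bound fun f => ?_
    rw [Real.coe_toNNReal _ (by positivity), inv_mul_eq_div, le_div_iff₀ (by positivity)]
    refine abs_le_of_sq_le_sq' ?_ (by positivity) |>.2
    rw [mul_pow, Real.sq_sqrt hA.le, mul_comm]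
    exact hCreal f
  let M : Submodule ℂ (lp (fun _ : ι => ℂ) 2) := LinearMap.range C.toLinearMap
  have hMc : IsClosed (M : Set (lp (fun _ : ι => ℂ) 2)) := by
    have : (M : Set (lp (fun _ : ι => ℂ) 2)) = range C := by ext; simp [M]
    rw [this]
    exact hanti.isClosed_range C.uniformContinuous
  have hMcs : CompleteSpace M := hMc.completeSpace_coe
  -- These w i form the canonical dual frame. The range M is closed because C is bounded below.
  have hw : ∀ i, ∃ w, C w = M.starProjection (lp.single 2 i (1 : ℂ)) := fun i =>
    M.starProjection_apply_mem (lp.single 2 i (1 : ℂ))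
  choose w hw using hw
  let W := Submodule.span ℂ (range fun i : F => w i)
  have hfd : FiniteDimensional ℂ W := FiniteDimensional.span_of_finite ℂ (finite_range _)
  refine ⟨W, hfd, (finrank_range_le_card _).trans (by simp), fun v => ?_⟩
  -- Here b truncates the coefficients of v to F and u is the corresponding reconstruction. As C v ∈
  -- M, C(v - u) = P_M(C v - b), so the lower frame bound controls v - u by the coefficients off F.
  let b : lp (fun _ : ι => ℂ) 2 := ∑ i ∈ F, inner ℂ (g i) v • lp.single 2 i (1 : ℂ)
  let u : H := ∑ i ∈ F, inner ℂ (g i) v • w i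
  have hu : u ∈ W := Submodule.sum_mem _ fun i hi =>
    W.smul_mem _ (Submodule.subset_span ⟨⟨i, hi⟩, rfl⟩)
  have hCu : C u = M.starProjection b := by
    simp only [u, b, map_sum, map_smul, hw]
  have hCvM : C v ∈ M := ⟨v, rfl⟩
  have hCv : C v = M.starProjection (C v) := (Submodule.starProjection_eq_self_iff.2 hCvM).symm
  have h1 : ‖Wᗮ.starProjection v‖ ≤ ‖v - u‖ := by
    have e : Wᗮ.starProjection v = Wᗮ.starProjection (v - u) := by
      have hu0 : Wᗮ.starProjection u = 0 := by
        rw [Submodule.starProjection_apply_eq_zero_iff]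
        exact W.le_orthogonal_orthogonal hu
      rw [map_sub, hu0, sub_zero]
    rw [e]
    exact Wᗮ.norm_starProjection_apply_le _
  have h2 : ‖C (v - u)‖ ≤ ‖C v - b‖ := by
    have e : C (v - u) = M.starProjection (C v - b) := by
      rw [map_sub, map_sub, ← hCv, hCu]
    rw [e]
    exact M.norm_starProjection_apply_le _
  have hb : ∀ i, b i = if i ∈ F then inner ℂ (g i) v else 0 := fun i => by
    simp only [b, lp.coeFn_sum, lp.coeFn_smul, Finset.sum_apply, Pi.smul_apply, lp.coeFn_single]
    simp [Pi.single_apply]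
  calc ENNReal.ofReal A * ‖Wᗮ.starProjection v‖ₑ ^ 2
      ≤ ENNReal.ofReal A * ‖v - u‖ₑ ^ 2 := by
        gcongr
        rwa [enorm_le_iff_norm_le]
    _ ≤ ‖C (v - u)‖ₑ ^ 2 := hClow _
    _ ≤ ‖C v - b‖ₑ ^ 2 := by
        gcongr
        rwa [enorm_le_iff_norm_le]
    _ = _ := by
        rw [lp_two_enorm_sq_eq_tsum]
        refine tsum_congr fun i => ?_
        rw [lp.coeFn_sub, Pi.sub_apply, hC, hb]
        by_cases hi : i ∈ F
        · simp [hi]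
        · simp [hi, enorm_inner_symm]

end HilbertFrame

namespace ProjectiveUnitaryRep

/-! ### Counting points of a frame and lower density -/

section Frame

variable {G H : Type*} [Group G] [TopologicalSpace G]
  [NormedAddCommGroup H] [InnerProductSpace ℂ H] {π : ProjectiveUnitaryRep G H}
  {Λ : Set G} {g : H}

theorem enorm_inner_toFun_toFun (π : ProjectiveUnitaryRep G H) (f g : H) (x y : G) :
    ‖inner ℂ (π.toFun y f) (π.toFun x g)‖ₑ = ‖π.coeff g f (y⁻¹ * x)‖ₑ := by
  rw [enorm_inner_eq_coeff, ← ofReal_norm, ← ofReal_norm, norm_coeff_translate]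

theorem IsFrame.ne_zero [Nontrivial H] (h : π.IsFrame Λ g) : g ≠ 0 := by
  rintro rfl
  obtain ⟨A, B, hA, -, h⟩ := h
  obtain ⟨v, hv⟩ := exists_ne (0 : H)
  have h1 := (h v).1
  simp only [map_zero, inner_zero_right, enorm_zero, ne_eq, OfNat.ofNat_ne_zero,
    not_false_eq_true, zero_pow, tsum_zero, nonpos_iff_eq_zero, ENNReal.ofReal_eq_zero] at h1
  have : 0 < ‖v‖ := norm_pos_iff.2 hv
  have : 0 < A * ‖v‖ ^ 2 := by positivity
  linarith

/-- The index set of a frame is relatively separated. -/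
theorem IsFrame.exists_tsum_indicator_le [Nontrivial H] (h : π.IsFrame Λ g) :
    ∃ (U : Set G) (N : ℝ≥0∞), IsOpen U ∧ 1 ∈ U ∧ N ≠ 0 ∧ N ≠ ∞ ∧
      ∀ y, ∑' l : Λ, U.indicator 1 (y⁻¹ * (l : G)) ≤ N := by
  have hg := h.ne_zero
  obtain ⟨A, B, -, hB, h⟩ := h
  have hpos : 0 < ‖π.coeff g g 1‖ₑ ^ 2 := by
    rw [← ofReal_norm, norm_coeff_one]
    exact pos_of_ne_zero
      (pow_ne_zero 2 (ENNReal.ofReal_pos.2 (norm_pos_iff.2 (inner_self_ne_zero.2 hg))).ne')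
  obtain ⟨s, hs0, hs⟩ := exists_between hpos
  have hst : s ≠ ∞ := ne_top_of_lt hs
  have hgn : 0 < ‖g‖ := norm_pos_iff.2 hg
  -- Each λ ∈ yU contributes more than s to the frame sum of π(y)g, which is at most B‖g‖².
  let U : Set G := {z | s < ‖π.coeff g g z‖ₑ ^ 2}
  refine ⟨U, ENNReal.ofReal (B * ‖g‖ ^ 2) / s,
    isOpen_lt continuous_const
      ((ENNReal.continuous_pow 2).comp (π.continuous_coeff g g).enorm), hs,
    (ENNReal.div_pos (ENNReal.ofReal_pos.2 (by positivity)).ne' hst).ne',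
    ENNReal.div_ne_top ENNReal.ofReal_ne_top hs0.ne', fun y => ?_⟩
  rw [ENNReal.le_div_iff_mul_le (Or.inl hs0.ne') (Or.inl hst), ← ENNReal.tsum_mul_right]
  have h2 := (h (π.toFun y g)).2
  rw [LinearIsometryEquiv.norm_map] at h2
  refine (ENNReal.tsum_le_tsum fun l => ?_).trans h2
  rw [enorm_inner_toFun_toFun]
  by_cases hz : y⁻¹ * (l : G) ∈ U
  · rw [indicator_of_mem hz, Pi.one_apply, one_mul]
    exact le_of_lt hz
  · rw [indicator_of_notMem hz, zero_mul]
    exact zero_le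

variable [MeasurableSpace G] [BorelSpace G] {μ : Measure G} {d : ℝ}

/-- The number of elements of a frame in a set controls the measure of the part of the set that is
far from its boundary. -/
theorem IsFormalDegree.measure_le_of_frame [CompleteSpace H]
    (hd : π.IsFormalDegree μ d) {A B : ℝ} (hA : 0 < A)
    (hlow : ∀ f : H, ENNReal.ofReal (A * ‖f‖ ^ 2) ≤ ∑' l : Λ, ‖inner ℂ f (π.toFun l g)‖ₑ ^ 2)
    (hup : ∀ f : H, ∑' l : Λ, ‖inner ℂ f (π.toFun l g)‖ₑ ^ 2 ≤ ENNReal.ofReal (B * ‖f‖ ^ 2))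
    {η : H} (hη : ‖η‖ = 1) {L : Set G} {δ : ℝ≥0∞}
    (htail : ∀ y, ∑' l : Λ, Lᶜ.indicator (fun z => ‖π.coeff g η z‖ₑ ^ 2) (y⁻¹ * (l : G))
      ≤ ENNReal.ofReal A * δ)
    {E K₀ : Set G} (hK₀ : MeasurableSet K₀) (hE : ∀ y ∈ K₀, ∀ z ∈ L, y * z ∈ E) :
    μ K₀ ≤ ((Λ ∩ E).encard : ℝ≥0∞) * ENNReal.ofReal d⁻¹ + δ * μ K₀ := by
  by_cases hfin : (Λ ∩ E).Finite
  swap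
  · rw [Set.Infinite.encard_eq hfin, ENat.toENNReal_top,
      ENNReal.top_mul (ENNReal.ofReal_pos.2 (inv_pos.2 hd.1)).ne', top_add]
    exact le_top
  have hA0 : ENNReal.ofReal A ≠ 0 := (ENNReal.ofReal_pos.2 hA).ne'
  have hfin' : ((↑) ⁻¹' E : Set Λ).Finite := by
    refine Set.Finite.of_finite_image (f := Subtype.val) ?_ Subtype.val_injective.injOn
    rwa [Subtype.image_preimage_coe]
  let F : Finset Λ := hfin'.toFinset
  have hF : (F.card : ℝ≥0∞) = ((Λ ∩ E).encard : ℝ≥0∞) := by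
    rw [← Subtype.image_preimage_coe, Subtype.val_injective.encard_image,
      hfin'.encard_eq_coe_toFinset_card]
    simp [F]
  obtain ⟨W, hfd, hrank, hW⟩ := exists_finiteDimensional_approx hA hlow hup F
  have hpt : ∀ y ∈ K₀, 1 ≤ ‖W.starProjection (π.toFun y η)‖ₑ ^ 2 + δ := by
    intro y hy
    -- By Pythagoras it suffices to bound the component in Wᗮ by δ. Only λ ∉ E enter that bound, and
    -- these satisfy y⁻¹λ ∉ L.
    have h1 := W.norm_sq_eq_add_norm_sq_starProjection (π.toFun y η)
    rw [LinearIsometryEquiv.norm_map, hη, one_pow] at h1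
    have h2 : 1 = ‖W.starProjection (π.toFun y η)‖ₑ ^ 2
        + ‖Wᗮ.starProjection (π.toFun y η)‖ₑ ^ 2 := by
      rw [← ofReal_norm, ← ofReal_norm, ← ENNReal.ofReal_pow (norm_nonneg _),
        ← ENNReal.ofReal_pow (norm_nonneg _), ← ENNReal.ofReal_add (by positivity) (by positivity)]
      simp at h1 ⊢
      rw [← h1]
      simp
    rw [h2]
    gcongr
    refine (ENNReal.mul_le_mul_iff_right hA0 ENNReal.ofReal_ne_top).1
      ((hW _).trans ((ENNReal.tsum_le_tsum fun l => ?_).trans (htail y)))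
    by_cases hl : l ∈ F
    · rw [indicator_of_notMem (by simpa using hl)]
      exact zero_le
    · have hlE : (l : G) ∉ E := by simpa [F] using hl
      have hlL : y⁻¹ * (l : G) ∈ Lᶜ := fun h => hlE (by simpa using hE y hy _ h)
      rw [indicator_of_mem (by simpa using hl), indicator_of_mem hlL, enorm_inner_toFun_toFun]
  calc μ K₀ = ∫⁻ _ in K₀, 1 ∂μ := by simp
    _ ≤ ∫⁻ y in K₀, (‖W.starProjection (π.toFun y η)‖ₑ ^ 2 + δ) ∂μ :=
        setLIntegral_mono' hK₀ hpt
    _ = ∫⁻ y in K₀, ‖W.starProjection (π.toFun y η)‖ₑ ^ 2 ∂μ + δ * μ K₀ := by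
        rw [lintegral_add_right _ measurable_const, setLIntegral_const]
    _ ≤ ∫⁻ y, ‖W.starProjection (π.toFun y η)‖ₑ ^ 2 ∂μ + δ * μ K₀ := by
        exact add_le_add_left (setLIntegral_le_lintegral _ _) _
    _ ≤ _ := by
        rw [hd.lintegral_enorm_sq_starProjection W hη, ← hF]
        gcongr

variable [IsTopologicalGroup G]

/-- Since Q may be uncountable, measurability comes from lower semicontinuity of a supremum of
continuous functions. -/
theorem measurable_iSup_enorm_coeff_sq (π : ProjectiveUnitaryRep G H) (η g : H) (Q : Set G) :
    Measurable fun x => (⨆ y ∈ Q, ‖inner ℂ η (π.toFun (x * y) g)‖ₑ) ^ 2 := by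
  have h : LowerSemicontinuous fun x => ⨆ y ∈ Q, ‖inner ℂ η (π.toFun (x * y) g)‖ₑ := by
    refine lowerSemicontinuous_biSup fun y _ => Continuous.lowerSemicontinuous ?_
    exact (continuous_const.inner
      ((π.continuous_apply g).comp (continuous_id.mul continuous_const))).enorm
  exact h.measurable.pow_const 2

variable [T2Space G] [LocallyCompactSpace G] [SecondCountableTopology G]

/-- Uniform decay, away from the diagonal, of the frame coefficients of coherent states. -/
theorem IsFrame.exists_isCompact_tsum_indicator_le [μ.IsHaarMeasure] [Nontrivial H]
    (h : π.IsFrame Λ g) {Q : Set G} (hQ : Q ∈ 𝓝 (1 : G)) (hQc : IsCompact (closure Q))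
    (hg : g ∈ π.B2 μ Q) (η : H) {δ : ℝ≥0∞} (hδ : 0 < δ) :
    ∃ L : Set G, IsCompact L ∧
      ∀ y, ∑' l : Λ, Lᶜ.indicator (fun z => ‖π.coeff g η z‖ₑ ^ 2) (y⁻¹ * (l : G)) ≤ δ := by
  obtain ⟨U, N, hU, hU1, hN0, hNt, hN⟩ := h.exists_tsum_indicator_le
  -- Inside U, translates of V have overlap at most N; inside Q, the local maximal function Θ
  -- dominates the coefficients.
  let V := U ∩ interior Q
  have hVo : IsOpen V := hU.inter isOpen_interior
  have hV1 : (1 : G) ∈ V := ⟨hU1, mem_interior_iff_mem_nhds.2 hQ⟩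
  have hVQ : V ⊆ Q := inter_subset_right.trans interior_subset
  -- The set of t with t⁻¹z ∈ V is zV⁻¹, so left invariance gives it measure m.
  let m := μ V⁻¹
  have hm0 : m ≠ 0 := (hVo.inv.measure_pos μ ⟨1, by simpa using hV1⟩).ne'
  have hmt : m ≠ ∞ :=
    ne_top_of_le_ne_top hQc.inv.measure_lt_top.ne
      (measure_mono (inv_subset_inv.2 (hVQ.trans subset_closure)))
  let Θ : G → ℝ≥0∞ := fun x => (⨆ y ∈ Q, ‖inner ℂ η (π.toFun (x * y) g)‖ₑ) ^ 2
  have hΘm : Measurable Θ := π.measurable_iSup_enorm_coeff_sq η g Q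
  have hΘ : ∀ t v, v ∈ V → ‖π.coeff g η (t * v)‖ₑ ^ 2 ≤ Θ t := fun t v hv => by
    rw [← enorm_inner_eq_coeff]
    have := le_iSup₂ (f := fun y (_ : y ∈ Q) => ‖inner ℂ η (π.toFun (t * y) g)‖ₑ) v (hVQ hv)
    exact pow_le_pow_left' this 2
  obtain ⟨L₁, hL₁, htail⟩ := exists_isCompact_setLIntegral_compl_le μ (hg η)
    (δ := δ * m / N) (ENNReal.div_pos (mul_ne_zero hδ.ne' hm0) hNt)
  -- For z outside this product, every t with t⁻¹z ∈ V avoids L₁, so averaging over t sees only the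
  -- tail of Θ.
  refine ⟨L₁ * closure Q, hL₁.mul hQc, fun y => ?_⟩
  set L := L₁ * closure Q
  -- bound a single coefficient by an integral
  have hmeas : ∀ z : G, MeasurableSet {t : G | t⁻¹ * z ∈ V} := fun z =>
    (hVo.preimage (continuous_inv.mul continuous_const)).measurableSet
  have hvol : ∀ z : G, μ {t : G | t⁻¹ * z ∈ V} = m := fun z => by
    rw [← measure_preimage_mul μ z]
    congr 1
    ext t
    simp
  have hone : ∀ z, m * Lᶜ.indicator (fun z => ‖π.coeff g η z‖ₑ ^ 2) z
      ≤ ∫⁻ t in L₁ᶜ, V.indicator 1 (t⁻¹ * z) * Θ t ∂μ := by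
    intro z
    by_cases hz : z ∈ L
    · rw [indicator_of_notMem (by simpa using hz), mul_zero]
      exact zero_le
    have hsub : {t : G | t⁻¹ * z ∈ V} ⊆ L₁ᶜ := fun t ht htL => by
      exact hz ⟨t, htL, t⁻¹ * z, subset_closure (hVQ ht), by simp⟩
    rw [indicator_of_mem hz, ← hvol z, mul_comm, ← setLIntegral_const]
    calc ∫⁻ _ in {t : G | t⁻¹ * z ∈ V}, ‖π.coeff g η z‖ₑ ^ 2 ∂μ
        ≤ ∫⁻ t in {t : G | t⁻¹ * z ∈ V}, V.indicator 1 (t⁻¹ * z) * Θ t ∂μ := by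
          refine setLIntegral_mono' (hmeas z) fun t ht => ?_
          have h1 := hΘ t _ ht
          rw [indicator_of_mem (show t⁻¹ * z ∈ V from ht), Pi.one_apply, one_mul]
          simpa using h1
      _ ≤ _ := lintegral_mono_set hsub
  have hsum : m * ∑' l : Λ, Lᶜ.indicator (fun z => ‖π.coeff g η z‖ₑ ^ 2) (y⁻¹ * (l : G))
      ≤ m * δ := by
    rw [← ENNReal.tsum_mul_left, ENNReal.tsum_eq_iSup_sum]
    refine iSup_le fun F => ?_
    calc ∑ l ∈ F, m * Lᶜ.indicator (fun z => ‖π.coeff g η z‖ₑ ^ 2) (y⁻¹ * (l : G))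
        ≤ ∑ l ∈ F, ∫⁻ t in L₁ᶜ, V.indicator 1 (t⁻¹ * (y⁻¹ * (l : G))) * Θ t ∂μ :=
          Finset.sum_le_sum fun l _ => hone _
      _ = ∫⁻ t in L₁ᶜ, ∑ l ∈ F, V.indicator 1 (t⁻¹ * (y⁻¹ * (l : G))) * Θ t ∂μ := by
          refine (lintegral_finsetSum _ fun l _ => Measurable.mul ?_ hΘm).symm
          exact (measurable_one.indicator hVo.measurableSet).comp
            (continuous_inv.mul continuous_const).measurable
      _ ≤ ∫⁻ t in L₁ᶜ, N * Θ t ∂μ := by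
          refine lintegral_mono fun t => ?_
          dsimp only
          rw [← Finset.sum_mul]
          gcongr
          -- The overlap bound at the point yt makes the estimate independent of y.
          refine (ENNReal.sum_le_tsum F).trans ((ENNReal.tsum_le_tsum fun l => ?_).trans
            (hN (y * t)))
          rw [mul_inv_rev, mul_assoc]
          exact indicator_le_indicator_of_subset inter_subset_left (fun _ => zero_le) _
      _ = N * ∫⁻ t in L₁ᶜ, Θ t ∂μ := lintegral_const_mul _ hΘm
      _ ≤ N * (δ * m / N) := by gcongr
      _ = m * δ := by rw [ENNReal.mul_div_cancel hN0 hNt, mul_comm]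
  exact (ENNReal.mul_le_mul_iff_right hm0 hmt).1 hsum

theorem IsFormalDegree.le_lowerBeurlingDensity_of_frame [μ.IsHaarMeasure] [Nontrivial H]
    [CompleteSpace H] (hd : π.IsFormalDegree μ d) {K : ℕ → Set G}
    (hK : IsStrongFolnerSequence μ K) {Q : Set G} (hQ : Q ∈ 𝓝 (1 : G))
    (hQc : IsCompact (closure Q)) (hg : g ∈ π.B2 μ Q) (h : π.IsFrame Λ g) :
    ENNReal.ofReal d ≤ lowerBeurlingDensity μ K Λ := by
  obtain ⟨η, hη⟩ := exists_norm_eq H zero_le_one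
  have htails := fun δ => h.exists_isCompact_tsum_indicator_le hQ hQc hg η (δ := δ)
  obtain ⟨A, B, hA, -, hfr⟩ := h
  have hA0 : ENNReal.ofReal A ≠ 0 := (ENNReal.ofReal_pos.2 hA).ne'
  set D := ENNReal.ofReal d with hD
  have hDinv : ENNReal.ofReal d⁻¹ = D⁻¹ := ENNReal.ofReal_inv_of_pos hd.1
  have hD0 : D ≠ 0 := (ENNReal.ofReal_pos.2 hd.1).ne'
  have hDt : D ≠ ∞ := ENNReal.ofReal_ne_top
  have key : ∀ δ : ℝ≥0∞, 0 < δ → δ < 1 → D * (1 - δ) ≤ lowerBeurlingDensity μ K Λ := by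
    intro δ hδ hδ1
    obtain ⟨L₀, hL₀, htail⟩ := htails (ENNReal.ofReal A * δ) (ENNReal.mul_pos hA0 hδ.ne')
    set L := insert 1 L₀
    have hL : IsCompact L := hL₀.insert 1
    have htailL : ∀ y, ∑' l : Λ, Lᶜ.indicator (fun z => ‖π.coeff g η z‖ₑ ^ 2) (y⁻¹ * (l : G))
        ≤ ENNReal.ofReal A * δ := fun y =>
      (ENNReal.tsum_le_tsum fun l => indicator_le_indicator_of_subset
        (compl_subset_compl.2 (subset_insert _ _)) (fun _ => zero_le) _).trans (htail y)
    let b : ℕ → ℝ≥0∞ := fun n => μ ((K n * L⁻¹) ∩ ((K n)ᶜ * L⁻¹))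
    have hbound : ∀ (n : ℕ) (x : G), D * ((1 - δ) * (1 - b n / μ (K n)))
        ≤ ((Λ ∩ x • K n).encard : ℝ≥0∞) / μ (K n) := by
      intro n x
      have hKn := hK.isCompact n
      have hμ0 := (hK.measure_pos n).ne'
      have hμt : μ (K n) ≠ ∞ := hKn.measure_lt_top.ne
      -- This is the set of y with yL ⊆ K_n. As 1 ∈ L, it lies in K_n and misses only points of the
      -- L⁻¹-boundary measured by `b n`.
      let K₀ := ((K n)ᶜ * L⁻¹)ᶜ
      have hK₀m : MeasurableSet K₀ :=
        (hKn.isClosed.isOpen_compl.mul_right (t := L⁻¹)).measurableSet.compl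
      have hK₀L : ∀ y ∈ K₀, ∀ z ∈ L, y * z ∈ K n := fun y hy z hz => by
        by_contra hyz
        exact hy ⟨y * z, hyz, z⁻¹, by simpa using hz, by simp⟩
      have h1L : (1 : G) ∈ L := mem_insert _ _
      have hK₀K : K₀ ⊆ K n := fun y hy => by simpa using hK₀L y hy 1 h1L
      have hK₀t : μ K₀ ≠ ∞ := ne_top_of_le_ne_top hμt (measure_mono hK₀K)
      have hcover : μ (K n) ≤ μ K₀ + b n := by
        refine (measure_mono fun y hy => ?_).trans (measure_union_le _ _)
        by_cases hyK : y ∈ K₀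
        · exact Or.inl hyK
        · exact Or.inr ⟨⟨y, hy, 1, by simpa using h1L, by simp⟩, not_not.1 hyK⟩
      have h1 := hd.measure_le_of_frame hA (fun f => (hfr f).1) (fun f => (hfr f).2) hη htailL
        (E := x • K n) (K₀ := x • K₀) (hK₀m.const_smul x) (by
          rintro _ ⟨y, hy, rfl⟩ z hz
          exact ⟨y * z, hK₀L y hy z hz, by simp [mul_assoc]⟩)
      rw [measure_smul, hDinv] at h1
      have h2 : (1 - δ) * μ K₀ ≤ ((Λ ∩ x • K n).encard : ℝ≥0∞) * D⁻¹ := by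
        rw [ENNReal.sub_mul fun _ _ => hK₀t, one_mul, tsub_le_iff_right]
        exact h1
      have h3 : 1 - b n / μ (K n) ≤ μ K₀ / μ (K n) := by
        rw [tsub_le_iff_right, ← ENNReal.add_div, ← ENNReal.div_self hμ0 hμt]
        gcongr
      calc D * ((1 - δ) * (1 - b n / μ (K n))) ≤ D * ((1 - δ) * (μ K₀ / μ (K n))) := by gcongr
        _ = D * ((1 - δ) * μ K₀) / μ (K n) := by simp only [div_eq_mul_inv, mul_assoc]
        _ ≤ D * (((Λ ∩ x • K n).encard : ℝ≥0∞) * D⁻¹) / μ (K n) := by gcongr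
        _ = _ := by
          rw [mul_comm (Set.encard _ : ℝ≥0∞), ← mul_assoc, ENNReal.mul_inv_cancel hD0 hDt, one_mul]
    have hlim : Tendsto (fun n => D * ((1 - δ) * (1 - b n / μ (K n)))) atTop
        (𝓝 (D * (1 - δ))) := by
      have h1 : Tendsto (fun n => 1 - b n / μ (K n)) atTop (𝓝 (1 - 0)) :=
        ENNReal.Tendsto.sub tendsto_const_nhds (hK.tendsto_boundary L⁻¹ hL.inv)
          (Or.inl ENNReal.one_ne_top)
      have h2 := ENNReal.Tendsto.const_mul (a := 1 - δ) h1
        (Or.inr (ENNReal.sub_ne_top ENNReal.one_ne_top))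
      have h3 := ENNReal.Tendsto.const_mul (a := D) h2 (Or.inr hDt)
      simpa using h3
    rw [lowerBeurlingDensity, ← hlim.liminf_eq]
    exact liminf_le_liminf (Eventually.of_forall fun n => le_iInf (hbound n))
  have hlim : Tendsto (fun δ : ℝ≥0∞ => D * (1 - δ)) (𝓝[>] 0) (𝓝 (D * (1 - 0))) :=
    ENNReal.Tendsto.const_mul (ENNReal.Tendsto.sub tendsto_const_nhds
      (tendsto_id.mono_left nhdsWithin_le_nhds) (Or.inl ENNReal.one_ne_top)) (Or.inr hDt)
  rw [tsub_zero, mul_one] at hlim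
  refine le_of_tendsto hlim ?_
  filter_upwards [self_mem_nhdsWithin, Ioo_mem_nhdsGT one_pos] with δ h1 h2
  exact key δ h1 h2.2

end Frame

end ProjectiveUnitaryRep

/-! ### The density theorem -/

theorem corollary1p4 {G H : Type*}
    [Group G] [TopologicalSpace G] [IsTopologicalGroup G] [T2Space G] [LocallyCompactSpace G]
    [SecondCountableTopology G] [MeasurableSpace G] [BorelSpace G]
    (μ : Measure G) [μ.IsHaarMeasure]
    -- `G` is unimodular and amenable
    [μ.IsMulRightInvariant] (hG : IsAmenableGroup μ)
    [NormedAddCommGroup H] [InnerProductSpace ℂ H] [CompleteSpace H]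
    (π : ProjectiveUnitaryRep G H) (hirr : π.IsIrreducible) (hsq : π.IsSquareIntegrable μ)
    (Λ : Set G) (hΛ : IsDiscrete Λ) (g : H)
    -- the strong Følner sequence that defines the Beurling densities
    (K : ℕ → Set G) (hK : IsStrongFolnerSequence μ K)
    -- the unit neighborhood that defines `𝓑²_π`
    (Q : Set G) (hQ : Q ∈ 𝓝 (1 : G)) (hQc : IsCompact (closure Q)) :
    (π.IsFrame Λ g → g ∈ π.B2 μ Q →
      ENNReal.ofReal (π.formalDegree μ) ≤ lowerBeurlingDensity μ K Λ) ∧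
    (π.IsRieszSequence Λ g →
      upperBeurlingDensity μ K Λ ≤ ENNReal.ofReal (π.formalDegree μ)) := by
  obtain ⟨v, hv, -⟩ := id hsq
  have : Nontrivial H := ⟨v, 0, hv⟩
  have hd := hirr.isFormalDegree_formalDegree μ hsq
  exact ⟨fun hf hg => hd.le_lowerBeurlingDensity_of_frame hK hQ hQc hg hf,
    fun hr => hd.upperBeurlingDensity_le_of_riesz hK.toIsFolnerSequence hr⟩
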